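/- Let $n\ge 3$, let $\zeta_n\in\mathbb{C}$ be a primitive $n$-th root of unity, $\mathcal{O}_n=\mathbb{Z}[\zeta_n]$ and $\phi$ Euler's function, and identify the plane with $\mathbb{C}$. Let $o_1,\dots,o_m\in\mathcal{O}_n\setminus\{0\}$, $m\ge 2$, be pairwise non-parallel. All of these are fixed, i.e. not part of the input. (a) For all $q_0,\dots,q_{\phi(n)-1}\in\mathbb{Q}$ one has $q_0+q_1\zeta_n+\dots+q_{\phi(n)-1}\zeta_n^{\phi(n)-1}\in\mathcal{O}_n$ if and only if $q_0,\dots,q_{\phi(n)-1}\in\mathbb{Z}$. (b) There are a real RAM program and a constant $C$, depending only on the fixed data, such that the following holds. Let $p_1,\dots,p_m$ be functions, where $p_i$ assigns a non-negative integer to every line of the plane parallel to $o_i$, has finite support, and vanishes outside the module lines $t+\mathbb{R}o_i$, $t\in\mathcal{O}_n$. Suppose that, for each $i$, the lines of $\operatorname{supp}(p_i)$ are given, each once and in any order, as $t+\mathbb{R}o_i$ with $t\in\mathcal{O}_n$ given by its integer coordinates with respect to $1,\zeta_n,\dots,\zeta_n^{\phi(n)-1}$, together with the values of $p_i$ on them.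 Then the program halts after at most $C\,(s^2+1)$ steps, where $s=\max_i\operatorname{card}(\operatorname{supp}(p_i))$, and outputs the partition of the grid $$G=\bigcap_{i=1}^m\ \bigcup_{\ell\in\operatorname{supp}(p_i)}\ell$$ into its equivalence classes for the relation $x\sim y:\Leftrightarrow x-y\in\mathcal{O}_n$: it lists every class once and, for each class, every point once, by its rational coordinates with respect to $1,\zeta_n,\dots,\zeta_n^{\phi(n)-1}$. Here a real RAM is a random access machine whose storage locations hold real numbers, with unit cost for each instruction: $+,-,\times,/$, rational constants, the comparison $<$ of two reals, the test whether a real is an integer, indirect addressing, (conditional) jumps, and reading or writing one real. -/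

import Mathlib

/-! ### The real RAM

A random access machine whose storage locations `0, 1, 2, …` hold one real number each.  It has
the four arithmetic operations, rational program constants, order comparison, the test whether
a register holds an integer, and indirect addressing.  Its input is read from an input tape, its
output is written to an output tape.  Each executed instruction has unit cost. -/

namespace RealRAM

/-- The instructions; `d`, `a`, `b` are register numbers, `l` is a position in the program. -/
inductive Instr where
  /-- `r[d] := q` -/
  | const (d : ℕ) (q : ℚ)
  /-- `r[d] := r[a]` -/
  | copy (d a : ℕ)
  /-- `r[d] := r[a] + r[b]` -/
  | add (d a b : ℕ)
  /-- `r[d] := r[a] - r[b]` -/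
  | sub (d a b : ℕ)
  /-- `r[d] := r[a] * r[b]` -/
  | mul (d a b : ℕ)
  /-- `r[d] := r[a] / r[b]`; the machine crashes if `r[b] = 0` -/
  | div (d a b : ℕ)
  /-- `r[d] := r[r[a]]`; the machine crashes if `r[a]` is not a natural number -/
  | load (d a : ℕ)
  /-- `r[r[a]] := r[b]`; the machine crashes if `r[a]` is not a natural number -/
  | store (a b : ℕ)
  /-- `goto l` -/
  | jump (l : ℕ)
  /-- `if r[a] < r[b] then goto l` -/
  | jumpLt (a b l : ℕ)
  /-- `if r[a]` is an integer `then goto l` -/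
  | jumpInt (a l : ℕ)
  /-- read the next real from the input tape into `r[d]`; crash if there is none -/
  | read (d : ℕ)
  /-- append `r[a]` to the output tape -/
  | write (a : ℕ)
  /-- stop -/
  | halt

/-- A program is a finite list of instructions. -/
abbrev Program := List Instr

/-- A configuration: program counter, memory, unread input, output written so far. -/
structure Config where
  pc : ℕ
  mem : ℕ → ℝ
  input : List ℝ
  output : List ℝ

/-- Start at instruction `0` with all registers `0`. -/
def Config.init (input : List ℝ) : Config where
  pc := 0
  mem := fun _ => 0
  input := input
  output := []

/-- Assign `x` to register `d` and go on with the next instruction. -/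
def Config.assign (c : Config) (d : ℕ) (x : ℝ) : Config :=
  { c with pc := c.pc + 1, mem := Function.update c.mem d x }

open Classical in
/-- The address denoted by a real number, if it is a natural number. -/
noncomputable def address (x : ℝ) : Option ℕ :=
  if x = (⌊x⌋₊ : ℝ) then some ⌊x⌋₊ else none

open Classical in
/-- The effect of one instruction; `none` for `halt` and for a crash. -/
noncomputable def exec (c : Config) : Instr → Option Config
  | .const d q => some (c.assign d (q : ℝ))
  | .copy d a => some (c.assign d (c.mem a))
  | .add d a b => some (c.assign d (c.mem a + c.mem b))
  | .sub d a b => some (c.assign d (c.mem a - c.mem b))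
  | .mul d a b => some (c.assign d (c.mem a * c.mem b))
  | .div d a b => if c.mem b = 0 then none else some (c.assign d (c.mem a / c.mem b))
  | .load d a => (address (c.mem a)).map fun k => c.assign d (c.mem k)
  | .store a b => (address (c.mem a)).map fun k => c.assign k (c.mem b)
  | .jump l => some { c with pc := l }
  | .jumpLt a b l => some { c with pc := if c.mem a < c.mem b then l else c.pc + 1 }
  | .jumpInt a l => some { c with pc := if ∃ z : ℤ, c.mem a = (z : ℝ) then l else c.pc + 1 }
  | .read d =>
    match c.input with
    | [] => none
    | x :: rest => some { (c.assign d x) with input := rest }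
  | .write a => some { c with pc := c.pc + 1, output := c.output ++ [c.mem a] }
  | .halt => none

/-- One step of program `P`. -/
noncomputable def step (P : Program) (c : Config) : Option Config :=
  P[c.pc]?.bind (exec c)

/-- `Reaches P c t c'`: program `P` leads from `c` to `c'` in exactly `t` steps. -/
inductive Reaches (P : Program) : Config → ℕ → Config → Prop where
  | refl (c : Config) : Reaches P c 0 c
  | next {c c' c'' : Config} {t : ℕ} (h : step P c = some c') (h' : Reaches P c' t c'') :
      Reaches P c (t + 1) c''

/-- On the given input, `P` arrives at a `halt` instruction after exactly `t` executed
instructions, having written `output`. -/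
def HaltsWith (P : Program) (input : List ℝ) (t : ℕ) (output : List ℝ) : Prop :=
  ∃ c : Config, Reaches P (Config.init input) t c ∧ P[c.pc]? = some Instr.halt ∧ c.output = output

end RealRAM

/-! ### Cyclotomic grids -/

namespace CycloTomo

/-- `O_n = ℤ[ζ]`, the smallest subring of `ℂ` containing `ζ`. -/
noncomputable def moduleO (ζ : ℂ) : Subalgebra ℤ ℂ := Algebra.adjoin ℤ {ζ}

/-- The number `q₀ + q₁ ζ + ⋯ + q_{φ(n)-1} ζ^{φ(n)-1}`. -/
noncomputable def ofCoords {n : ℕ} (ζ : ℂ) (q : Fin (Nat.totient n) → ℚ) : ℂ :=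
  ∑ k, (q k : ℂ) * ζ ^ (k : ℕ)

/-- The line `t + ℝ o` in the plane `ℂ`. -/
def lineSet (t o : ℂ) : Set ℂ := {z | ∃ r : ℝ, z = t + (r : ℂ) * o}

/-- The set of lines in direction `o`, as a type. -/
def Line (o : ℂ) : Type := {ℓ : Set ℂ // ∃ t : ℂ, ℓ = lineSet t o}

/-- The line in direction `o` through `t`. -/
def Line.through (o t : ℂ) : Line o := ⟨lineSet t o, t, rfl⟩

/-- The module lines in direction `o`: those through a point of `ℤ[ζ]`. -/
def moduleLines (ζ o : ℂ) : Set (Line o) := {ℓ | ∃ t ∈ moduleO ζ, ℓ = Line.through o t}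

/-- The grid of the data `p`: the points which lie, for every `i`, on a line of the support of
`p i`. -/
def grid {m : ℕ} {o : Fin m → ℂ} (p : (i : Fin m) → Line (o i) → ℕ) : Set ℂ :=
  ⋂ i, ⋃ ℓ ∈ Function.support (p i), ℓ.1

/-- Equivalence modulo `ℤ[ζ]`. -/
def ModEquiv (ζ x y : ℂ) : Prop := x - y ∈ moduleO ζ

/-- The equivalence classes modulo `ℤ[ζ]` in a set `G`. -/
def classesIn (ζ : ℂ) (G : Set ℂ) : Set (Set ℂ) :=
  {A | ∃ x ∈ G, A = {y | y ∈ G ∧ ModEquiv ζ x y}}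

/-- The largest cardinality of a support. -/
noncomputable def maxSupport {m : ℕ} {o : Fin m → ℂ} (p : (i : Fin m) → Line (o i) → ℕ) : ℕ :=
  Finset.univ.sup fun i => (Function.support (p i)).ncard

/-- A line `t + ℝ o` with its value: the integer coordinates of `t ∈ ℤ[ζ]`, and the value. -/
abbrev Entry (n : ℕ) : Type := (Fin (Nat.totient n) → ℤ) × ℕ

/-- The line of an entry. -/
noncomputable def Entry.line {n : ℕ} (ζ o : ℂ) (e : Entry n) : Line o :=
  Line.through o (ofCoords ζ fun k => (e.1 k : ℚ))

/-- `L` lists the lines of the support of `p`, each exactly once, with their values. -/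
def Represents {n : ℕ} (ζ : ℂ) {o : ℂ} (p : Line o → ℕ) (L : List (Entry n)) : Prop :=
  (L.map (Entry.line ζ o)).Nodup ∧ (∀ e ∈ L, p (Entry.line ζ o e) = e.2) ∧
    ∀ ℓ, ℓ ∈ Function.support p ↔ ∃ e ∈ L, Entry.line ζ o e = ℓ

/-- The input tape: for each direction in turn the number of lines, followed for each line by its
`φ(n)` coordinates and its value. -/
def encodeInput {n m : ℕ} (L : Fin m → List (Entry n)) : List ℝ :=
  (List.ofFn fun i =>
    ((L i).length : ℝ) :: (L i).flatMap fun e => List.ofFn (fun k => (e.1 k : ℝ)) ++ [(e.2 : ℝ)]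
  ).flatten

/-- The output tape for a list of lists of points, given by their rational coordinates: the number
of lists, followed for each list by its length and the `φ(n)` coordinates of each of its points. -/
def encodeOutput {n : ℕ} (Q : List (List (Fin (Nat.totient n) → ℚ))) : List ℝ :=
  (Q.length : ℝ) :: Q.flatMap fun l =>
    (l.length : ℝ) :: l.flatMap fun q => List.ofFn fun k => (q k : ℝ)

/-- The set of points of a list of coordinate vectors. -/
noncomputable def pointSet {n : ℕ} (ζ : ℂ) (l : List (Fin (Nat.totient n) → ℚ)) : Set ℂ :=
  {z | ∃ q ∈ l, ofCoords ζ q = z}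

/-- `Q` lists the members of the family `𝒜` of sets, each exactly once, and for each member it
lists all its points, each exactly once. -/
def ListsFamily {n : ℕ} (ζ : ℂ) (𝒜 : Set (Set ℂ))
    (Q : List (List (Fin (Nat.totient n) → ℚ))) : Prop :=
  (∀ l ∈ Q, l.Nodup) ∧ (Q.map (pointSet ζ)).Nodup ∧ ∀ A, A ∈ 𝒜 ↔ A ∈ Q.map (pointSet ζ)

end CycloTomo

/-! The lines with direction `o` are the fibres of `I_o(z) = z ō - z̄ o`, and `I_o` maps `ℤ[ζ]` to
itself when `o ∈ ℤ[ζ]`. If `D = I_o(o') ≠ 0`, then the lines `I_o = a` and `I_o' = b` meet in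
`(a o' - b o) / D`. As `D` divides a positive integer `N` in `ℤ[ζ]`, the grid is contained in
`N⁻¹ ℤ[ζ]`, so that each of its classes is given by one of the `N ^ φ(n)` vectors of coordinates
modulo `N`. In coordinates all these maps are linear with fixed integer matrices. Hence each of the
at most `s²` points where a line of the first list meets a line of the second is found in constant
time, and so is its class. Whether it lies on one of the given lines with direction `o_i` is also
decided in constant time: for every given line the machine marks a register, whose address is an
injective polynomial function of the invariant of the line. -/

namespace RealRAM

section Execution

variable {P A B : Program} {c c' c'' : Config} {pc s t : ℕ} {i : Instr}

/-- The instructions `B` are found in the program `P` from position `pc` on. -/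
def CodeAt (P : Program) (pc : ℕ) (B : Program) : Prop :=
  ∃ pre suf, P = pre ++ B ++ suf ∧ pre.length = pc

theorem CodeAt.left (h : CodeAt P pc (A ++ B)) : CodeAt P pc A := by
  obtain ⟨pre, suf, rfl, h⟩ := h
  exact ⟨pre, B ++ suf, by simp, h⟩

theorem CodeAt.right (h : CodeAt P pc (A ++ B)) : CodeAt P (pc + A.length) B := by
  obtain ⟨pre, suf, rfl, h⟩ := h
  exact ⟨pre ++ A, suf, by simp, by simp [h]⟩

theorem CodeAt.head (h : CodeAt P pc (i :: B)) : P[pc]? = some i := by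
  obtain ⟨pre, suf, rfl, rfl⟩ := h
  simp

theorem CodeAt.tail (h : CodeAt P pc (i :: B)) : CodeAt P (pc + 1) B :=
  CodeAt.right (A := [i]) h

theorem Reaches.trans (h : Reaches P c s c') (h' : Reaches P c' t c'') :
    Reaches P c (s + t) c'' := by
  induction h with
  | refl c => simpa only [Nat.zero_add] using h'
  | next hstep _ ih =>
    rw [Nat.add_right_comm]
    exact .next hstep (ih h')

theorem Reaches.snoc (h : Reaches P c t c') (hi : P[c'.pc]? = some i)
    (hexec : exec c' i = some c'') : Reaches P c (t + 1) c'' :=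
  h.trans (.next (by simp [step, hi, hexec]) (.refl c''))

/-- Wherever the block `B` is placed so that `c` points to its beginning, the machine runs from `c`
in `t` steps to `c'`, which points to its end. Blocks are relocatable in this sense, so the program
around them does not have to be mentioned. -/
structure RunsThrough (B : Program) (c : Config) (t : ℕ) (c' : Config) : Prop where
  pc_eq : c'.pc = c.pc + B.length
  reaches (P : Program) : CodeAt P c.pc B → Reaches P c t c'

theorem RunsThrough.nil (c : Config) : RunsThrough [] c 0 c :=
  ⟨rfl, fun _ _ => .refl c⟩

theorem RunsThrough.append (h : RunsThrough A c s c') (h' : RunsThrough B c' t c'') :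
    RunsThrough (A ++ B) c (s + t) c'' where
  pc_eq := by rw [h'.pc_eq, h.pc_eq, List.length_append, add_assoc]
  reaches P hP := (h.reaches P hP.left).trans (h'.reaches P (by rw [h.pc_eq]; exact hP.right))

theorem RunsThrough.single (hexec : exec c i = some c') (hpc : c'.pc = c.pc + 1) :
    RunsThrough [i] c 1 c' where
  pc_eq := hpc
  reaches _ hP := (Reaches.refl c).snoc hP.head hexec

theorem RunsThrough.snoc (h : RunsThrough A c t c') (hexec : exec c' i = some c'')
    (hpc : c''.pc = c'.pc + 1) : RunsThrough (A ++ [i]) c (t + 1) c'' :=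
  h.append (.single hexec hpc)

theorem address_natCast (k : ℕ) : address (k : ℝ) = some k := by
  simp [address]

end Execution

section Coding

/-- An injective polynomial coding of integers by natural numbers. -/
def intCode (a : ℤ) : ℕ := (2 * a * a + a).toNat

theorem natCast_intCode (a : ℤ) : (intCode a : ℤ) = 2 * a * a + a := by
  refine Int.toNat_of_nonneg ?_
  rcases le_or_gt 0 a with h | h
  · positivity
  · nlinarith

theorem intCode_injective : Function.Injective intCode := by
  intro a b h
  have hcode : 2 * a * a + a = 2 * b * b + b := by
    rw [← natCast_intCode, ← natCast_intCode, h]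
  have hmul : (a - b) * (2 * (a + b) + 1) = 0 := by linear_combination hcode
  rcases mul_eq_zero.1 hmul with h | h <;> omega

theorem add_sq_add_left_inj {u v u' v' : ℕ} (h : (u + v) ^ 2 + u = (u' + v') ^ 2 + u') :
    u = u' ∧ v = v' := by
  have hsum : u + v = u' + v' := by
    rw [← Nat.sqrt_add_eq' (u + v) (a := u) (by omega), h, Nat.sqrt_add_eq' _ (by omega)]
  rw [hsum] at h
  omega

/-- An injective coding of lists of integers by natural numbers. It is polynomial in the entries of
a list of given length, so that a real RAM, which has no bit operations, can compute it in constant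
time. -/
def listCode : List ℤ → ℕ
  | [] => 0
  | a :: l => (intCode a + listCode l) ^ 2 + intCode a + 1

theorem listCode_injective : Function.Injective listCode := by
  intro l
  induction l with
  | nil =>
    rintro (_ | ⟨b, l'⟩) h
    · rfl
    · simp [listCode] at h
  | cons a l ih =>
    rintro (_ | ⟨b, l'⟩) h
    · simp [listCode] at h
    · obtain ⟨hhead, htail⟩ := add_sq_add_left_inj (Nat.succ.inj h)
      rw [intCode_injective hhead, ih htail]

end Coding

/-- Integer polynomials in variables of type `V`. -/
inductive PolyExpr (V : Type*) where
  | const (z : ℤ)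
  | var (v : V)
  | plus (e f : PolyExpr V)
  | times (e f : PolyExpr V)

namespace PolyExpr

variable {V : Type*}

/-- The value of an expression under an assignment of integers to the variables. -/
def eval (x : V → ℤ) : PolyExpr V → ℤ
  | const z => z
  | var v => x v
  | plus e f => e.eval x + f.eval x
  | times e f => e.eval x * f.eval x

/-- The expression for the `listCode` of the values of a list of expressions. -/
def listCode : List (PolyExpr V) → PolyExpr V
  | [] => const 0
  | e :: l =>
    let u := plus (times (times (const 2) e) e) e
    let s := plus u (listCode l)
    plus (plus (times s s) u) (const 1)

theorem eval_listCode (x : V → ℤ) (l : List (PolyExpr V)) :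
    (listCode l).eval x = RealRAM.listCode (l.map (eval x)) := by
  induction l with
  | nil => rfl
  | cons e l ih =>
    simp only [listCode, eval, ih, List.map_cons, RealRAM.listCode]
    push_cast [natCast_intCode]
    ring

/-- The sum of a list of expressions. -/
def sum : List (PolyExpr V) → PolyExpr V
  | [] => const 0
  | e :: l => plus e (sum l)

theorem eval_sum (x : V → ℤ) (l : List (PolyExpr V)) :
    (sum l).eval x = (l.map (eval x)).sum := by
  induction l with
  | nil => rfl
  | cons e l ih => simp only [sum, eval, ih, List.map_cons, List.sum_cons]

end PolyExpr

section Registers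

variable {V : Type*}

/-- The register of a variable. Registers are divided by their residue modulo `3` into registers
for variables, for intermediate results, and for the cells of the store. -/
def varReg [Encodable V] (v : V) : ℕ := 3 * Encodable.encode v

/-- The register of the `t`-th intermediate result. -/
def tmpReg (t : ℕ) : ℕ := 3 * t + 1

/-- The register of the store cell whose address is the list `a`. -/
def cellReg (a : List ℤ) : ℕ := 3 * listCode a + 2

/-- The expression for the register of the store cell with the given address. -/
def PolyExpr.cellReg (es : List (PolyExpr V)) : PolyExpr V :=
  .plus (.times (.const 3) (.listCode es)) (.const 2)

theorem PolyExpr.eval_cellReg (x : V → ℤ) (es : List (PolyExpr V)) :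
    (PolyExpr.cellReg es).eval x = RealRAM.cellReg (es.map (PolyExpr.eval x)) := by
  simp [PolyExpr.cellReg, PolyExpr.eval, PolyExpr.eval_listCode, RealRAM.cellReg]

variable [Encodable V]

theorem varReg_inj {v w : V} : varReg v = varReg w ↔ v = w := by
  rw [varReg, varReg, mul_right_inj' three_ne_zero, Encodable.encode_inj]

theorem tmpReg_inj {s t : ℕ} : tmpReg s = tmpReg t ↔ s = t := by
  unfold tmpReg; omega

theorem cellReg_inj {a b : List ℤ} : cellReg a = cellReg b ↔ a = b := by
  rw [← listCode_injective.eq_iff, cellReg, cellReg]; omega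

theorem varReg_ne_tmpReg (v : V) (t : ℕ) : varReg v ≠ tmpReg t := by
  unfold varReg tmpReg; omega

theorem cellReg_ne_tmpReg (a : List ℤ) (t : ℕ) : cellReg a ≠ tmpReg t := by
  unfold cellReg tmpReg; omega

theorem varReg_ne_cellReg (v : V) (a : List ℤ) : varReg v ≠ cellReg a := by
  unfold varReg cellReg; omega

end Registers

section States

variable {V : Type*}

/-- A state of the structured language: integer values of the variables, a store of integers
addressed by lists of integers, the unread input, and the output written so far. -/
structure State (V : Type*) where
  vars : V → ℤ
  store : List ℤ → ℤ
  input : List ℤ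
  output : List ℚ

namespace State

/-- Assignment to a variable. -/
def set [DecidableEq V] (σ : State V) (v : V) (z : ℤ) : State V :=
  { σ with vars := Function.update σ.vars v z }

/-- Assignment to a cell of the store. -/
def setCell (σ : State V) (a : List ℤ) (z : ℤ) : State V :=
  { σ with store := Function.update σ.store a z }

end State

variable [Encodable V]

/-- The configuration `c` of the machine represents the state `σ`; nothing is required of the
registers for intermediate results. -/
structure Represented (σ : State V) (c : Config) : Prop where
  vars : ∀ v, c.mem (varReg v) = σ.vars v
  store : ∀ a, c.mem (cellReg a) = σ.store a
  input : c.input = σ.input.map (fun z : ℤ => (z : ℝ))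
  output : c.output = σ.output.map (fun q : ℚ => (q : ℝ))

namespace Represented

variable {σ : State V} {c : Config}

theorem withPc (h : Represented σ c) (l : ℕ) : Represented σ { c with pc := l } :=
  ⟨h.vars, h.store, h.input, h.output⟩

theorem assignTmp (h : Represented σ c) (t : ℕ) (r : ℝ) :
    Represented σ (c.assign (tmpReg t) r) where
  vars v := (Function.update_of_ne (varReg_ne_tmpReg v t) _ _).trans (h.vars v)
  store a := (Function.update_of_ne (cellReg_ne_tmpReg a t) _ _).trans (h.store a)
  input := h.input
  output := h.output

theorem assignVar [DecidableEq V] (h : Represented σ c) (v : V) (z : ℤ) :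
    Represented (σ.set v z) (c.assign (varReg v) z) where
  vars w := by
    rcases eq_or_ne w v with rfl | hw
    · simp [Config.assign, State.set]
    · simp [Config.assign, State.set, hw, varReg_inj, h.vars]
  store a := by
    simp [Config.assign, State.set, (varReg_ne_cellReg v a).symm, h.store]
  input := h.input
  output := h.output

theorem assignCell (h : Represented σ c) (a : List ℤ) (z : ℤ) :
    Represented (σ.setCell a z) (c.assign (cellReg a) z) where
  vars w := by
    simp [Config.assign, State.setCell, varReg_ne_cellReg w a, h.vars]
  store b := by
    rcases eq_or_ne b a with rfl | hb
    · simp [Config.assign, State.setCell]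
    · simp [Config.assign, State.setCell, hb, cellReg_inj, h.store]
  input := h.input
  output := h.output

end Represented

end States

section Evaluation

variable {V : Type*} [Encodable V] {σ : State V} {c : Config}

/-- The instructions evaluating an expression into the `t`-th register for intermediate results;
they only change registers for intermediate results from the `t`-th one on. -/
def PolyExpr.compile : PolyExpr V → ℕ → Program
  | const z, t => [.const (tmpReg t) z]
  | var v, t => [.copy (tmpReg t) (varReg v)]
  | plus e f, t =>
    e.compile t ++ f.compile (t + 1) ++ [.add (tmpReg t) (tmpReg t) (tmpReg (t + 1))]
  | times e f, t =>
    e.compile t ++ f.compile (t + 1) ++ [.mul (tmpReg t) (tmpReg t) (tmpReg (t + 1))]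

theorem Represented.compile (h : Represented σ c) (e : PolyExpr V) (t : ℕ) :
    ∃ c', RunsThrough (e.compile t) c (e.compile t).length c' ∧ Represented σ c' ∧
      c'.mem (tmpReg t) = e.eval σ.vars ∧ ∀ j < t, c'.mem (tmpReg j) = c.mem (tmpReg j) := by
  have hframe (c : Config) (r : ℝ) {t j : ℕ} (hj : j < t) :
      (c.assign (tmpReg t) r).mem (tmpReg j) = c.mem (tmpReg j) :=
    Function.update_of_ne (tmpReg_inj.not.2 hj.ne) _ _
  induction e generalizing t c with
  | const z =>
    exact ⟨_, .single rfl rfl, h.assignTmp t _, by simp [Config.assign, PolyExpr.eval],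
      fun j hj => hframe _ _ hj⟩
  | var v =>
    exact ⟨_, .single rfl rfl, h.assignTmp t _, by simp [Config.assign, PolyExpr.eval, h.vars],
      fun j hj => hframe _ _ hj⟩
  | plus e f ihe ihf | times e f ihe ihf =>
    obtain ⟨c₁, hrun₁, h₁, heval₁, hkeep₁⟩ := ihe h t
    obtain ⟨c₂, hrun₂, h₂, heval₂, hkeep₂⟩ := ihf h₁ (t + 1)
    refine ⟨_, by simpa [PolyExpr.compile, add_assoc] using (hrun₁.append hrun₂).snoc rfl rfl,
      h₂.assignTmp t _, ?_, fun j hj => ?_⟩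
    · simp [Config.assign, PolyExpr.eval, heval₂, hkeep₂ t t.lt_succ_self, heval₁]
    · rw [hframe _ _ hj, hkeep₂ j (hj.trans t.lt_succ_self), hkeep₁ j hj]

theorem Represented.compile_cellReg (h : Represented σ c) (es : List (PolyExpr V)) (t : ℕ) :
    ∃ c', RunsThrough ((PolyExpr.cellReg es).compile t) c
        ((PolyExpr.cellReg es).compile t).length c' ∧ Represented σ c' ∧
      address (c'.mem (tmpReg t)) = some (cellReg (es.map (PolyExpr.eval σ.vars))) ∧
      ∀ j < t, c'.mem (tmpReg j) = c.mem (tmpReg j) := by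
  obtain ⟨c', hrun, h', heval, hkeep⟩ := h.compile (PolyExpr.cellReg es) t
  refine ⟨c', hrun, h', ?_, hkeep⟩
  rw [heval, PolyExpr.eval_cellReg, Int.cast_natCast, address_natCast]

/-- The instructions computing the product of an expression and a rational number. -/
def PolyExpr.compileScaled (e : PolyExpr V) (q : ℚ) : Program :=
  e.compile 0 ++ [.const (tmpReg 1) q] ++ [.mul (tmpReg 0) (tmpReg 0) (tmpReg 1)]

theorem Represented.compileScaled (h : Represented σ c) (e : PolyExpr V) (q : ℚ) :
    ∃ c', RunsThrough (e.compileScaled q) c (e.compileScaled q).length c' ∧ Represented σ c' ∧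
      c'.mem (tmpReg 0) = ((e.eval σ.vars * q : ℚ) : ℝ) := by
  obtain ⟨c₁, hrun, h₁, heval, -⟩ := h.compile e 0
  refine ⟨_, by simpa [PolyExpr.compileScaled] using (hrun.snoc rfl rfl).snoc rfl rfl,
    (h₁.assignTmp 1 q).assignTmp 0 _, ?_⟩
  simp [Config.assign, Function.update_of_ne (tmpReg_inj.not.2 zero_ne_one), heval]

end Evaluation

/-- Conditions for branching: a strict inequality between two expressions, integrality of an
expression multiplied by a rational number, and positivity of a cell of the store. -/
inductive Guard (V : Type*) where
  | lt (e f : PolyExpr V)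
  | int (e : PolyExpr V) (q : ℚ)
  | pos (es : List (PolyExpr V))

namespace Guard

variable {V : Type*}

/-- The truth value of a condition in a state. -/
def Holds (σ : State V) : Guard V → Prop
  | lt e f => e.eval σ.vars < f.eval σ.vars
  | int e q => ∃ z : ℤ, e.eval σ.vars * q = z
  | pos es => 0 < σ.store (es.map (PolyExpr.eval σ.vars))

/-- The instructions preparing the conditional jump `branch`. -/
def prepare [Encodable V] : Guard V → Program
  | lt e f => e.compile 0 ++ f.compile 1
  | int e q => e.compileScaled q
  | pos es =>
    (PolyExpr.cellReg es).compile 0 ++ [.load (tmpReg 1) (tmpReg 0)] ++ [.const (tmpReg 0) 0]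

/-- The conditional jump to `l` on a condition. -/
def branch : Guard V → ℕ → Instr
  | lt _ _, l => .jumpLt (tmpReg 0) (tmpReg 1) l
  | int _ _, l => .jumpInt (tmpReg 0) l
  | pos _, l => .jumpLt (tmpReg 0) (tmpReg 1) l

end Guard

section Branching

variable {V : Type*} {σ : State V} {c : Config}

open Classical in
theorem exec_branch_lt {e f : PolyExpr V} (he : c.mem (tmpReg 0) = e.eval σ.vars)
    (hf : c.mem (tmpReg 1) = f.eval σ.vars) (l : ℕ) :
    exec c ((Guard.lt e f).branch l) =
      some { c with pc := if (Guard.lt e f).Holds σ then l else c.pc + 1 } := by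
  have hlt : c.mem (tmpReg 0) < c.mem (tmpReg 1) ↔ (Guard.lt e f).Holds σ := by
    rw [he, hf, Int.cast_lt, Guard.Holds]
  simp only [exec, Guard.branch, hlt]

open Classical in
theorem exec_branch_int {e : PolyExpr V} {q : ℚ}
    (he : c.mem (tmpReg 0) = ((e.eval σ.vars * q : ℚ) : ℝ)) (l : ℕ) :
    exec c ((Guard.int e q).branch l) =
      some { c with pc := if (Guard.int e q).Holds σ then l else c.pc + 1 } := by
  have hinteger : (∃ z : ℤ, c.mem (tmpReg 0) = z) ↔ (Guard.int e q).Holds σ :=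
    exists_congr fun z => by rw [he]; exact_mod_cast Iff.rfl
  simp only [exec, Guard.branch, hinteger]

open Classical in
theorem exec_branch_pos {es : List (PolyExpr V)} (hzero : c.mem (tmpReg 0) = 0)
    (hcell : c.mem (tmpReg 1) = σ.store (es.map (PolyExpr.eval σ.vars))) (l : ℕ) :
    exec c ((Guard.pos es).branch l) =
      some { c with pc := if (Guard.pos es).Holds σ then l else c.pc + 1 } := by
  have hpos : c.mem (tmpReg 0) < c.mem (tmpReg 1) ↔ (Guard.pos es).Holds σ := by
    rw [hzero, hcell, Int.cast_pos, Guard.Holds]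
  simp only [exec, Guard.branch, hpos]

open Classical in
theorem Represented.prepare [Encodable V] (h : Represented σ c) (g : Guard V) :
    ∃ c', RunsThrough g.prepare c g.prepare.length c' ∧ Represented σ c' ∧
      ∀ l, exec c' (g.branch l) =
        some { c' with pc := if g.Holds σ then l else c'.pc + 1 } := by
  cases g with
  | lt e f =>
    obtain ⟨c₁, hrun₁, h₁, he, -⟩ := h.compile e 0
    obtain ⟨c₂, hrun₂, h₂, hf, hkeep⟩ := h₁.compile f 1
    exact ⟨c₂, by simpa [Guard.prepare] using hrun₁.append hrun₂, h₂,
      exec_branch_lt ((hkeep 0 one_pos).trans he) hf⟩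
  | int e q =>
    obtain ⟨c₁, hrun, h₁, he⟩ := h.compileScaled e q
    exact ⟨c₁, hrun, h₁, exec_branch_int he⟩
  | pos es =>
    obtain ⟨c₁, hrun, h₁, haddr, -⟩ := h.compile_cellReg es 0
    have hload : exec c₁ (.load (tmpReg 1) (tmpReg 0)) =
        some (c₁.assign (tmpReg 1) (σ.store (es.map (PolyExpr.eval σ.vars)))) := by
      simp only [exec, haddr, Option.map_some, h₁.store]
    refine ⟨_, by simpa [Guard.prepare] using (hrun.snoc hload rfl).snoc rfl rfl,
      (h₁.assignTmp 1 _).assignTmp 0 _, exec_branch_pos (by simp [Config.assign]) ?_⟩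
    simp [Config.assign, Function.update_of_ne (tmpReg_inj.not.2 one_ne_zero)]

end Branching

section Tests

variable {V : Type*} [Encodable V] {σ : State V} {c : Config}

/-- The instructions, to be placed at position `pc`, which skip the following `l` instructions
unless the condition `g` holds. -/
def Guard.test (g : Guard V) (pc l : ℕ) : Program :=
  let body := pc + g.prepare.length + 2
  g.prepare ++ [g.branch body, .jump (body + l)]

theorem Guard.length_test (g : Guard V) (pc l : ℕ) :
    (g.test pc l).length = g.prepare.length + 2 := by
  simp [Guard.test]

theorem Represented.exists_enter (h : Represented σ c) {g : Guard V} (hg : g.Holds σ) :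
    ∃ c', c'.pc = c.pc + (g.prepare.length + 2) ∧ Represented σ c' ∧
      ∀ P l, CodeAt P c.pc (g.test c.pc l) → Reaches P c (g.prepare.length + 1) c' := by
  obtain ⟨c', hrun, h', hbranch⟩ := h.prepare g
  refine ⟨{ c' with pc := c.pc + g.prepare.length + 2 }, add_assoc _ _ _, h'.withPc _,
    fun P l hP => ?_⟩
  refine (hrun.reaches P hP.left).snoc (i := g.branch (c.pc + g.prepare.length + 2)) ?_ ?_
  · rw [hrun.pc_eq]; exact hP.right.head
  · rw [hbranch, if_pos hg]

theorem Represented.exists_skip (h : Represented σ c) {g : Guard V} (hg : ¬ g.Holds σ)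
    (B : Program) :
    ∃ c', RunsThrough (g.test c.pc B.length ++ B) c (g.prepare.length + 2) c' ∧
      Represented σ c' := by
  obtain ⟨c', hrun, h', hbranch⟩ := h.prepare g
  refine ⟨{ c' with pc := c.pc + g.prepare.length + 2 + B.length }, ⟨?_, fun P hP => ?_⟩,
    h'.withPc _⟩
  · simp only [List.length_append, Guard.length_test, add_assoc]
  · refine ((hrun.reaches P hP.left.left).snoc (i := g.branch (c.pc + g.prepare.length + 2))
      (c'' := { c' with pc := c'.pc + 1 }) ?_ ?_).snoc
        (i := .jump (c.pc + g.prepare.length + 2 + B.length)) ?_ rfl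
    · rw [hrun.pc_eq]; exact hP.left.right.head
    · rw [hbranch, if_neg hg]
    · simp only [hrun.pc_eq]; exact hP.left.right.tail.head

end Tests

/-- Statements of a structured language which is compiled to the real RAM. In `write e q` the
number written is the product of `e` and the rational constant `q`. -/
inductive Stmt (V : Type*) where
  | skip
  | seq (a b : Stmt V)
  | set (v : V) (e : PolyExpr V)
  | load (v : V) (es : List (PolyExpr V))
  | store (es : List (PolyExpr V)) (e : PolyExpr V)
  | read (v : V)
  | write (e : PolyExpr V) (q : ℚ)
  | cond (g : Guard V) (a : Stmt V)
  | loop (g : Guard V) (a : Stmt V)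

namespace Stmt

variable {V : Type*}

/-- The program of a statement, to be placed at position `pc`. -/
def compile [Encodable V] : Stmt V → ℕ → Program
  | skip, _ => []
  | seq a b, pc => a.compile pc ++ b.compile (pc + (a.compile pc).length)
  | set v e, _ => e.compile 0 ++ [.copy (varReg v) (tmpReg 0)]
  | load v es, _ => (PolyExpr.cellReg es).compile 0 ++ [.load (varReg v) (tmpReg 0)]
  | store es e, _ =>
    e.compile 0 ++ (PolyExpr.cellReg es).compile 1 ++ [.store (tmpReg 1) (tmpReg 0)]
  | read v, _ => [.read (varReg v)]
  | write e q, _ => e.compileScaled q ++ [.write (tmpReg 0)]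
  | cond g a, pc =>
    let body := a.compile (pc + (g.prepare.length + 2))
    g.test pc body.length ++ body
  | loop g a, pc =>
    let body := a.compile (pc + (g.prepare.length + 2)) ++ [.jump pc]
    g.test pc body.length ++ body

/-- A bound for the number of steps, provided that no loop makes more than `S` rounds. -/
def cost [Encodable V] (S : ℕ) : Stmt V → ℕ
  | skip => 0
  | seq a b => a.cost S + b.cost S
  | set _ e => (e.compile 0).length + 1
  | load _ es => ((PolyExpr.cellReg es).compile 0).length + 1
  | store es e => (e.compile 0).length + ((PolyExpr.cellReg es).compile 1).length + 1
  | read _ => 1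
  | write e q => (e.compileScaled q).length + 1
  | cond g a => g.prepare.length + 2 + a.cost S
  | loop g a => S * (g.prepare.length + 2 + a.cost S) + (g.prepare.length + 2)

/-- The weakest precondition for a loop with condition `g` to make exactly `n` rounds, given the
predicate transformer `w` of its body. -/
def rounds (g : Guard V) (w : (State V → Prop) → State V → Prop) (Q : State V → Prop) :
    ℕ → State V → Prop
  | 0, σ => ¬ g.Holds σ ∧ Q σ
  | n + 1, σ => g.Holds σ ∧ w (rounds g w Q n) σ

open Classical in
/-- The weakest precondition for a statement to terminate in a state with property `Q`, with at
most `S` rounds in every execution of a loop. -/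
def wp [DecidableEq V] (S : ℕ) : Stmt V → (State V → Prop) → State V → Prop
  | skip, Q, σ => Q σ
  | seq a b, Q, σ => a.wp S (b.wp S Q) σ
  | set v e, Q, σ => Q (σ.set v (e.eval σ.vars))
  | load v es, Q, σ => Q (σ.set v (σ.store (es.map (PolyExpr.eval σ.vars))))
  | store es e, Q, σ => Q (σ.setCell (es.map (PolyExpr.eval σ.vars)) (e.eval σ.vars))
  | read v, Q, σ => ∃ z l, σ.input = z :: l ∧ Q { σ.set v z with input := l }
  | write e q, Q, σ => Q { σ with output := σ.output ++ [e.eval σ.vars * q] }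
  | cond g a, Q, σ => if g.Holds σ then a.wp S Q σ else Q σ
  | loop g a, Q, σ => ∃ n ≤ S, rounds g (a.wp S) Q n σ

section Soundness

variable [DecidableEq V] [Encodable V] {S : ℕ} {a b : Stmt V} {g : Guard V}

/-- The compiled statement `s` does what the weakest precondition promises, within the time given
by the cost. -/
def Sound (S : ℕ) (s : Stmt V) : Prop :=
  ∀ ⦃σ : State V⦄ ⦃c : Config⦄ ⦃Q : State V → Prop⦄, Represented σ c → s.wp S Q σ →
    ∃ t ≤ s.cost S, ∃ c' σ', RunsThrough (s.compile c.pc) c t c' ∧ Represented σ' c' ∧ Q σ'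

theorem sound_seq (ha : a.Sound S) (hb : b.Sound S) : (seq a b).Sound S := by
  intro σ c Q h hwp
  obtain ⟨t₁, ht₁, c₁, σ₁, hrun₁, h₁, hwp₁⟩ := ha h hwp
  obtain ⟨t₂, ht₂, c₂, σ₂, hrun₂, h₂, hQ⟩ := hb h₁ hwp₁
  rw [hrun₁.pc_eq] at hrun₂
  exact ⟨t₁ + t₂, add_le_add ht₁ ht₂, c₂, σ₂, hrun₁.append hrun₂, h₂, hQ⟩

theorem sound_set (v : V) (e : PolyExpr V) : (set v e).Sound S := by
  intro σ c Q h hwp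
  obtain ⟨c₁, hrun, h₁, heval, -⟩ := h.compile e 0
  exact ⟨_, le_rfl, _, _, hrun.snoc (by simp only [exec, heval]) rfl, h₁.assignVar v _, hwp⟩

theorem sound_load (v : V) (es : List (PolyExpr V)) : (load v es).Sound S := by
  intro σ c Q h hwp
  obtain ⟨c₁, hrun, h₁, haddr, -⟩ := h.compile_cellReg es 0
  exact ⟨_, le_rfl, _, _, hrun.snoc (by simp only [exec, haddr, Option.map_some, h₁.store]) rfl,
    h₁.assignVar v _, hwp⟩

theorem sound_store (es : List (PolyExpr V)) (e : PolyExpr V) : (store es e).Sound S := by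
  intro σ c Q h hwp
  obtain ⟨c₁, hrun₁, h₁, heval, -⟩ := h.compile e 0
  obtain ⟨c₂, hrun₂, h₂, haddr, hkeep⟩ := h₁.compile_cellReg es 1
  exact ⟨_, le_rfl, _, _, (hrun₁.append hrun₂).snoc
    (by simp only [exec, haddr, Option.map_some, hkeep 0 one_pos, heval]) rfl,
    h₂.assignCell _ _, hwp⟩

theorem sound_read (v : V) : (read v).Sound S := by
  rintro σ c Q h ⟨z, l, hinput, hQ⟩
  have hc : c.input = (z : ℝ) :: l.map (fun z : ℤ => (z : ℝ)) := by
    rw [h.input, hinput, List.map_cons]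
  have h' := h.assignVar v z
  exact ⟨1, le_rfl, { c.assign (varReg v) z with input := l.map (fun z : ℤ => (z : ℝ)) },
    { σ.set v z with input := l }, .single (by simp only [exec, hc]) rfl,
    ⟨h'.vars, h'.store, rfl, h'.output⟩, hQ⟩

theorem sound_write (e : PolyExpr V) (q : ℚ) : (write e q).Sound S := by
  intro σ c Q h hwp
  obtain ⟨c₁, hrun, h₁, heval⟩ := h.compileScaled e q
  exact ⟨_, le_rfl, _, { σ with output := σ.output ++ [e.eval σ.vars * q] }, hrun.snoc rfl rfl,
    ⟨h₁.vars, h₁.store, h₁.input, by simp [h₁.output, heval]⟩, hwp⟩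

theorem sound_cond (ha : a.Sound S) : (cond g a).Sound S := by
  intro σ c Q h hwp
  by_cases hg : g.Holds σ
  · rw [wp, if_pos hg] at hwp
    obtain ⟨c₁, hpc, h₁, henter⟩ := h.exists_enter hg
    obtain ⟨t, ht, c₂, σ₂, hrun, h₂, hQ⟩ := ha h₁ hwp
    rw [hpc] at hrun
    refine ⟨_, ?_, c₂, σ₂, ⟨?_, fun P hP => (henter P _ hP.left).trans (hrun.reaches P ?_)⟩, h₂, hQ⟩
    · rw [cost]; omega
    · rw [hrun.pc_eq, hpc, compile, List.length_append, Guard.length_test, add_assoc]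
    · have hbody := hP.right
      rw [g.length_test] at hbody
      rwa [hpc]
  · rw [wp, if_neg hg] at hwp
    obtain ⟨c₁, hrun, h₁⟩ := h.exists_skip hg (a.compile (c.pc + (g.prepare.length + 2)))
    exact ⟨_, by rw [cost]; omega, c₁, σ, hrun, h₁, hwp⟩

theorem exists_runsThrough_of_rounds (ha : a.Sound S) {Q : State V → Prop} (n : ℕ) {σ : State V}
    {c : Config} (h : Represented σ c) (hwp : rounds g (a.wp S) Q n σ) :
    ∃ t ≤ n * (g.prepare.length + 2 + a.cost S) + (g.prepare.length + 2), ∃ c' σ',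
      RunsThrough ((loop g a).compile c.pc) c t c' ∧ Represented σ' c' ∧ Q σ' := by
  induction n generalizing σ c with
  | zero =>
    obtain ⟨c₁, hrun, h₁⟩ := h.exists_skip hwp.1
      (a.compile (c.pc + (g.prepare.length + 2)) ++ [.jump c.pc])
    exact ⟨_, by omega, c₁, σ, hrun, h₁, hwp.2⟩
  | succ n ih =>
    obtain ⟨c₁, hpc, h₁, henter⟩ := h.exists_enter hwp.1
    obtain ⟨t₂, ht₂, c₂, σ₂, hrun, h₂, hwp₂⟩ := ha h₁ hwp.2
    rw [hpc] at hrun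
    obtain ⟨t₃, ht₃, c₃, σ₃, hloop, h₃, hQ⟩ := ih (h₂.withPc c.pc) hwp₂
    refine ⟨g.prepare.length + 1 + t₂ + 1 + t₃, ?_, c₃, σ₃, ⟨hloop.pc_eq, fun P hP => ?_⟩, h₃, hQ⟩
    · rw [Nat.succ_mul]; omega
    · have hbody := hP.right
      rw [g.length_test] at hbody
      refine (((henter P _ hP.left).trans (hrun.reaches P ?_)).snoc (i := .jump c.pc) ?_ rfl).trans
        (hloop.reaches P hP)
      · rw [hpc]; exact hbody.left
      · rw [hrun.pc_eq, hpc]; exact hbody.right.head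

theorem sound_loop (ha : a.Sound S) : (loop g a).Sound S := by
  rintro σ c Q h ⟨n, hn, hwp⟩
  obtain ⟨t, ht, hrun⟩ := exists_runsThrough_of_rounds ha n h hwp
  exact ⟨t, ht.trans (Nat.add_le_add_right (Nat.mul_le_mul_right _ hn) _), hrun⟩

theorem sound (S : ℕ) (s : Stmt V) : s.Sound S := by
  induction s with
  | skip => exact fun σ c Q h hwp => ⟨0, le_rfl, c, σ, .nil c, h, hwp⟩
  | seq a b ha hb => exact sound_seq ha hb
  | set v e => exact sound_set v e
  | load v es => exact sound_load v es
  | store es e => exact sound_store es e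
  | read v => exact sound_read v
  | write e q => exact sound_write e q
  | cond g a ha => exact sound_cond ha
  | loop g a ha => exact sound_loop ha

/-- The program executing a statement from the initial configuration. -/
def toProgram (s : Stmt V) : Program := s.compile 0 ++ [.halt]

theorem haltsWith_toProgram {s : Stmt V} {input : List ℤ} {output : List ℚ}
    (hwp : s.wp S (fun σ => σ.output = output) ⟨fun _ => 0, fun _ => 0, input, []⟩) :
    ∃ t ≤ s.cost S, HaltsWith s.toProgram (input.map fun z : ℤ => (z : ℝ)) t
      (output.map fun q : ℚ => (q : ℝ)) := by
  have hcode : CodeAt s.toProgram 0 (s.compile 0 ++ [.halt]) := ⟨[], [], by simp [toProgram], rfl⟩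
  have hinit : Represented (V := V) ⟨fun _ => 0, fun _ => 0, input, []⟩
      (Config.init (input.map fun z : ℤ => (z : ℝ))) := by
    constructor <;> simp [Config.init]
  obtain ⟨t, ht, c, σ, hrun, h, hQ⟩ := s.sound S hinit hwp
  refine ⟨t, ht, c, hrun.reaches _ hcode.left, ?_, by rw [h.output, hQ]⟩
  rw [hrun.pc_eq]
  exact hcode.right.head

end Soundness

/-- A statement repeated for the members of a fixed list, which is unrolled in the program. -/
def block {α : Type*} (f : α → Stmt V) : List α → Stmt V
  | [] => skip
  | x :: l => seq (f x) (block f l)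

/-- A statement executed if all guards of a list hold. -/
def guarded (a : Stmt V) : List (Guard V) → Stmt V
  | [] => a
  | g :: l => cond g (guarded a l)

section Rules

variable [DecidableEq V] {S : ℕ} {Q : State V → Prop} {σ : State V}

theorem wp_mono {s : Stmt V} {Q' : State V → Prop} (h : s.wp S Q σ) (hQ : ∀ σ, Q σ → Q' σ) :
    s.wp S Q' σ := by
  induction s generalizing Q Q' σ with
  | skip | set | load | store | write => exact hQ _ h
  | seq a b iha ihb => exact iha h fun _ hb => ihb hb hQ
  | read v => exact h.imp fun z => Exists.imp fun l => And.imp_right (hQ _)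
  | cond g a ih =>
    by_cases hg : g.Holds σ
    · rw [wp, if_pos hg] at h ⊢
      exact ih h hQ
    · rw [wp, if_neg hg] at h ⊢
      exact hQ _ h
  | loop g a ih =>
    obtain ⟨n, hn, h⟩ := h
    refine ⟨n, hn, ?_⟩
    clear hn
    induction n generalizing σ with
    | zero => exact ⟨h.1, hQ _ h.2⟩
    | succ n ihn => exact ⟨h.1, ih h.2 fun _ => ihn⟩

theorem wp_seq {a b : Stmt V} {R : State V → Prop} (ha : a.wp S R σ)
    (hb : ∀ σ, R σ → b.wp S Q σ) : (seq a b).wp S Q σ := by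
  rw [wp]
  exact wp_mono ha hb

/-- The loop runs through a list; `I pre suf` is an invariant for the moment when the entries
`pre` are done and the entries `suf` are left. -/
theorem wp_loop {g : Guard V} {a : Stmt V} {α : Type*} (l : List α) (hS : l.length ≤ S)
    (I : List α → List α → State V → Prop) (hstart : I [] l σ)
    (hstep : ∀ pre x suf, l = pre ++ x :: suf → ∀ σ, I pre (x :: suf) σ →
      g.Holds σ ∧ a.wp S (I (pre ++ [x]) suf) σ)
    (hend : ∀ σ, I l [] σ → ¬ g.Holds σ ∧ Q σ) : (loop g a).wp S Q σ := by
  refine ⟨l.length, hS, ?_⟩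
  suffices H : ∀ suf pre σ, l = pre ++ suf → I pre suf σ → rounds g (a.wp S) Q suf.length σ from
    H l [] σ rfl hstart
  intro suf
  induction suf with
  | nil =>
    rintro pre σ rfl hI
    rw [List.append_nil] at hend
    exact hend σ hI
  | cons x suf ih =>
    intro pre σ hl hI
    obtain ⟨hg, ha⟩ := hstep pre x suf hl σ hI
    exact ⟨hg, wp_mono ha fun σ' => ih (pre ++ [x]) σ' (by rw [hl, List.append_cons])⟩

theorem wp_block {α : Type*} {f : α → Stmt V} (l : List α)
    (I : List α → List α → State V → Prop) (hstart : I [] l σ)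
    (hstep : ∀ pre x suf, l = pre ++ x :: suf → ∀ σ, I pre (x :: suf) σ →
      (f x).wp S (I (pre ++ [x]) suf) σ) : (block f l).wp S (I l []) σ := by
  suffices H : ∀ suf pre σ, l = pre ++ suf → I pre suf σ → (block f suf).wp S (I l []) σ from
    H l [] σ rfl hstart
  intro suf
  induction suf with
  | nil =>
    rintro pre σ rfl hI
    rwa [List.append_nil]
  | cons x suf ih =>
    intro pre σ hl hI
    exact wp_seq (hstep pre x suf hl σ hI) fun σ' =>
      ih (pre ++ [x]) σ' (by rw [hl, List.append_cons])

theorem wp_guarded {a : Stmt V} (l : List (Guard V))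
    (hpos : (∀ g ∈ l, g.Holds σ) → a.wp S Q σ) (hneg : (¬ ∀ g ∈ l, g.Holds σ) → Q σ) :
    (guarded a l).wp S Q σ := by
  induction l with
  | nil => exact hpos (List.forall_mem_nil _)
  | cons g l ih =>
    rw [List.forall_mem_cons] at hpos hneg
    rw [guarded, wp]
    by_cases hg : g.Holds σ
    · rw [if_pos hg]
      exact ih (fun h => hpos ⟨hg, h⟩) fun h => hneg fun h' => h h'.2
    · rw [if_neg hg]
      exact hneg fun h => hg h.1

end Rules

section CostBound

variable [Encodable V] {a b : Stmt V} {k : ℕ}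

/-- The running time of a statement grows at most like `S ^ k` with the bound `S` for the number
of rounds of its loops. -/
def CostBound (s : Stmt V) (k : ℕ) : Prop := ∃ K, ∀ S, s.cost S ≤ K * (S + 1) ^ k

theorem CostBound.of_const {s : Stmt V} {K : ℕ} (h : ∀ S, s.cost S = K) (k : ℕ) :
    CostBound s k :=
  ⟨K, fun S => (h S).trans_le (Nat.le_mul_of_pos_right _ (by positivity))⟩

theorem CostBound.seq (ha : CostBound a k) (hb : CostBound b k) : CostBound (Stmt.seq a b) k := by
  obtain ⟨K, hK⟩ := ha
  obtain ⟨L, hL⟩ := hb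
  exact ⟨K + L, fun S => (add_le_add (hK S) (hL S)).trans_eq (add_mul ..).symm⟩

theorem CostBound.cond (ha : CostBound a k) (g : Guard V) : CostBound (Stmt.cond g a) k := by
  obtain ⟨K, hK⟩ := ha
  refine ⟨g.prepare.length + 2 + K, fun S => ?_⟩
  rw [add_mul]
  exact add_le_add (Nat.le_mul_of_pos_right _ (by positivity)) (hK S)

theorem CostBound.loop (ha : CostBound a k) (g : Guard V) :
    CostBound (Stmt.loop g a) (k + 1) := by
  obtain ⟨K, hK⟩ := ha.cond g
  refine ⟨K, fun S => ?_⟩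
  calc (Stmt.loop g a).cost S ≤ (S + 1) * (Stmt.cond g a).cost S := by
        simp only [cost, add_mul, one_mul, mul_add]
        lia
    _ ≤ (S + 1) * (K * (S + 1) ^ k) := Nat.mul_le_mul_left _ (hK S)
    _ = K * (S + 1) ^ (k + 1) := by ring

theorem CostBound.block {α : Type*} {f : α → Stmt V} (h : ∀ x, CostBound (f x) k) (l : List α) :
    CostBound (Stmt.block f l) k := by
  induction l with
  | nil => exact CostBound.of_const (fun _ => rfl) k
  | cons x l ih => exact (h x).seq ih

theorem CostBound.guarded (ha : CostBound a k) (l : List (Guard V)) :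
    CostBound (Stmt.guarded a l) k := by
  induction l with
  | nil => exact ha
  | cons g l ih => exact ih.cond g

end CostBound

end Stmt

variable {d : ℕ}

section Expressions

variable {V : Type*}

/-- The coordinates of the image of a vector of expressions under a linear map. -/
def linExpr (F : (Fin d → ℤ) →ₗ[ℤ] (Fin d → ℤ)) (es : Fin d → PolyExpr V) (k : Fin d) :
    PolyExpr V :=
  .sum ((List.finRange d).map fun j => .times (.const (F (Pi.single j 1) k)) (es j))

theorem eval_linExpr (x : V → ℤ) (F : (Fin d → ℤ) →ₗ[ℤ] (Fin d → ℤ)) (es : Fin d → PolyExpr V)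
    (k : Fin d) : (linExpr F es k).eval x = F (fun j => (es j).eval x) k := by
  have hF := congrFun (F.pi_apply_eq_sum_univ fun j => (es j).eval x) k
  simp only [Finset.sum_apply, Pi.smul_apply, smul_eq_mul] at hF
  rw [linExpr, PolyExpr.eval_sum, List.map_map, hF, ← List.sum_ofFn, List.ofFn_eq_map]
  refine congrArg List.sum (List.map_congr_left fun j _ => ?_)
  rw [mul_comm]
  exact congrArg (fun v => F v k * (es j).eval x)
    (funext fun i => by simp [Pi.single_apply, eq_comm])

/-- The address of coordinate `k` of the `j`-th vector in the array with number `i`. -/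
def arrayCell (i j : ℤ) (k : Fin d) : List ℤ := [0, i, j, (k : ℕ)]

theorem arrayCell_injective (i j : ℤ) : Function.Injective (arrayCell (d := d) i j) := by
  intro k k' h
  simpa [arrayCell, Fin.val_inj] using h

theorem arrayCell_ne {i i' j j' : ℤ} (h : i = i' → j ≠ j') (k k' : Fin d) :
    arrayCell i j k ≠ arrayCell i' j' k' := by
  intro h'
  simp only [arrayCell, List.cons.injEq] at h'
  exact h h'.2.1 h'.2.2.1

/-- The expressions for the address `RealRAM.arrayCell`. -/
def arrayExpr (i : ℤ) (j : V) (k : Fin d) : List (PolyExpr V) :=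
  [.const 0, .const i, .var j, .const (k : ℕ)]

theorem map_eval_arrayExpr (x : V → ℤ) (i : ℤ) (j : V) (k : Fin d) :
    (arrayExpr i j k).map (PolyExpr.eval x) = arrayCell i (x j) k := rfl

end Expressions

section FoldlUpdate

variable {α β γ : Type*} [DecidableEq β] {x : α → β}

theorem foldl_update_of_forall_ne (e : α → γ) {b : β} (h : ∀ a, x a ≠ b) (l : List α) (f : β → γ) :
    l.foldl (fun f a => Function.update f (x a) (e a)) f b = f b := by
  induction l generalizing f with
  | nil => rfl
  | cons a l ih => rw [List.foldl_cons, ih, Function.update_of_ne (h a).symm]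

theorem foldl_update_apply (hx : Function.Injective x) (e : α → γ) (l : List α) (f : β → γ) {a : α}
    (h : a ∈ l ∨ f (x a) = e a) :
    l.foldl (fun f a => Function.update f (x a) (e a)) f (x a) = e a := by
  induction l generalizing f with
  | nil => exact h.resolve_left List.not_mem_nil
  | cons a' l ih =>
    refine ih _ ?_
    beta_reduce
    by_cases ha : a = a'
    · rw [ha, Function.update_self]
      exact Or.inr rfl
    · rw [Function.update_of_ne (hx.ne ha)]
      exact h.imp_left fun h => (List.mem_cons.1 h).resolve_left ha

theorem foldl_update_finRange {x : Fin d → β} (hx : Function.Injective x) (e : Fin d → γ)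
    (f : β → γ) :
    (List.finRange d).foldl (fun f k => Function.update f (x k) (e k)) f
      = Function.extend x e f := by
  funext b
  by_cases hb : ∃ k, x k = b
  · obtain ⟨k, rfl⟩ := hb
    rw [hx.extend_apply, foldl_update_apply hx e _ _ (Or.inl (List.mem_finRange k))]
  · rw [Function.extend_apply' _ _ _ hb, foldl_update_of_forall_ne e (not_exists.1 hb)]

end FoldlUpdate

namespace Stmt

variable {V : Type*}

/-- Reading a vector into the variables `x`. -/
def readVec (x : Fin d → V) : Stmt V := block (fun k => read (x k)) (List.finRange d)

/-- Loading the vector with the index `j` in the array `i` into the variables `x`. -/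
def loadVec (x : Fin d → V) (i : ℤ) (j : V) : Stmt V :=
  block (fun k => load (x k) (arrayExpr i j k)) (List.finRange d)

/-- Storing the variables `x` as the vector with the index `j` in the array `i`. -/
def storeVec (x : Fin d → V) (i : ℤ) (j : V) : Stmt V :=
  block (fun k => store (arrayExpr i j k) (.var (x k))) (List.finRange d)

/-- Writing the product of a vector and the rational constant `q`. -/
def writeVec (es : Fin d → PolyExpr V) (q : ℚ) : Stmt V :=
  block (fun k => write (es k) q) (List.finRange d)

variable [DecidableEq V] {S : ℕ} {Q : State V → Prop} {σ : State V} {x : Fin d → V}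

theorem wp_block_of_eq {α : Type*} {f : α → Stmt V} {l : List α} (T : List α → List α → State V)
    (hstart : T [] l = σ)
    (hstep : ∀ pre x suf, (f x).wp S (· = T (pre ++ [x]) suf) (T pre (x :: suf)))
    (hend : Q (T l [])) : (block f l).wp S Q σ :=
  wp_mono (wp_block l (fun pre suf => (· = T pre suf)) hstart.symm
    fun pre x suf _ _ hσ => hσ ▸ hstep pre x suf) fun _ hσ => hσ ▸ hend

theorem wp_readVec (hx : Function.Injective x) {e : Fin d → ℤ} {rest : List ℤ}
    (hinput : σ.input = List.ofFn e ++ rest)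
    (hQ : Q { σ with vars := Function.extend x e σ.vars, input := rest }) :
    (readVec x).wp S Q σ := by
  refine wp_block_of_eq (fun pre suf => { σ with
    vars := pre.foldl (fun f k => Function.update f (x k) (e k)) σ.vars
    input := suf.map e ++ rest }) ?_ (fun pre k suf => ⟨e k, suf.map e ++ rest, rfl, ?_⟩) ?_
  · rw [← List.ofFn_eq_map, ← hinput]
    rfl
  · simp only [List.foldl_concat, State.set]
  · rwa [foldl_update_finRange hx]

theorem wp_loadVec (hx : Function.Injective x) {j : V} (hj : ∀ k, x k ≠ j) {i : ℤ}
    {e : Fin d → ℤ} (hstore : ∀ k, σ.store (arrayCell i (σ.vars j) k) = e k)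
    (hQ : Q { σ with vars := Function.extend x e σ.vars }) :
    (loadVec x i j).wp S Q σ := by
  refine wp_block_of_eq (fun pre _ => { σ with
    vars := pre.foldl (fun f k => Function.update f (x k) (e k)) σ.vars }) rfl
    (fun pre k _ => ?_) ?_
  · simp only [wp, State.set, map_eval_arrayExpr, foldl_update_of_forall_ne e hj, hstore,
      List.foldl_concat]
  · rwa [foldl_update_finRange hx]

theorem wp_storeVec (i : ℤ) (j : V)
    (hQ : Q { σ with
      store := Function.extend (arrayCell i (σ.vars j)) (fun k => σ.vars (x k)) σ.store }) :
    (storeVec x i j).wp S Q σ := by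
  refine wp_block_of_eq (fun pre _ => { σ with
    store := pre.foldl (fun f k => Function.update f (arrayCell i (σ.vars j) k) (σ.vars (x k)))
      σ.store }) rfl (fun pre k _ => ?_) ?_
  · simp only [wp, State.setCell, map_eval_arrayExpr, PolyExpr.eval, List.foldl_concat]
  · rwa [foldl_update_finRange (arrayCell_injective i _)]

theorem wp_writeVec (es : Fin d → PolyExpr V) (q : ℚ)
    (hQ : Q { σ with output := σ.output ++ List.ofFn fun k => (es k).eval σ.vars * q }) :
    (writeVec es q).wp S Q σ := by
  refine wp_block_of_eq (fun pre _ => { σ with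
    output := σ.output ++ pre.map fun k => (es k).eval σ.vars * q }) ?_ (fun pre k _ => ?_) ?_
  · rw [List.map_nil, List.append_nil]
  · simp only [wp, List.map_append, List.map_singleton, List.append_assoc]
  · rwa [← List.ofFn_eq_map]

end Stmt

end RealRAM

namespace CycloTomo

open RealRAM

/-- The variables of the grid program: the indices and the coordinates of the current lines in the
`outer` and in the `inner` loop, the counters for the points of a class and for the classes, a
place for the values of the lines, which are not needed, and the lengths of the lists. -/
inductive GridVar (d m : ℕ) where
  | outer
  | inner
  | count
  | classes
  | value
  | length (i : Fin m)
  | row (k : Fin d)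
  | col (k : Fin d)
  deriving DecidableEq, Encodable

/-- A list of lines, given by integer vectors, with their values. -/
abbrev LineList (d : ℕ) := List ((Fin d → ℤ) × ℕ)

/-- The arithmetic of a grid in integer coordinates. Two vectors give the same line of direction
`i` if `key i` takes the same value. The line of direction `i₀` given by `x` and the line of
direction `i₁` given by `y` meet in the point with the coordinates `(fst x + snd y) / denom`. -/
structure GridData (d m : ℕ) where
  denom : ℕ
  key : Fin m → (Fin d → ℤ) →ₗ[ℤ] (Fin d → ℤ)
  fst : (Fin d → ℤ) →ₗ[ℤ] (Fin d → ℤ)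
  snd : (Fin d → ℤ) →ₗ[ℤ] (Fin d → ℤ)
  i₀ : Fin m
  i₁ : Fin m

namespace GridData

variable {d m S : ℕ} (𝒟 : GridData d m)

/-- The address which is marked by a positive number if the list for direction `i` contains a line
whose key is `v / denom`. -/
def markCell (i : Fin m) (v : Fin d → ℤ) : List ℤ := 1 :: (i : ℕ) :: List.ofFn v

theorem markCell_inj {i i' : Fin m} {v v' : Fin d → ℤ} :
    markCell i v = markCell i' v' ↔ i = i' ∧ v = v' := by
  simp only [markCell, List.cons.injEq, true_and, Nat.cast_inj, Fin.val_inj, List.ofFn_inj]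

theorem markCell_ne_arrayCell (i : Fin m) (v : Fin d → ℤ) (i' j : ℤ) (k : Fin d) :
    markCell i v ≠ arrayCell i' j k := by
  simp [markCell, arrayCell]

/-- The expressions for the address `CycloTomo.GridData.markCell`. -/
def markExpr {V : Type*} (i : Fin m) (es : Fin d → PolyExpr V) : List (PolyExpr V) :=
  .const 1 :: .const (i : ℕ) :: List.ofFn es

theorem map_eval_markExpr {V : Type*} (x : V → ℤ) (i : Fin m) (es : Fin d → PolyExpr V) :
    (markExpr i es).map (PolyExpr.eval x) = markCell i fun k => (es k).eval x := by
  simp only [markExpr, markCell, List.map_cons, List.map_ofFn, Function.comp_def, PolyExpr.eval]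

/-- The store holds the lists `L`: the vectors in an array, and the marks of their keys. -/
structure Loaded (L : Fin m → LineList d) (st : List ℤ → ℤ) : Prop where
  array : ∀ {i pre e suf}, L i = pre ++ e :: suf → ∀ k,
    st (arrayCell (i : ℕ) pre.length k) = e.1 k
  mark : ∀ i v, 0 < st (markCell i v) ↔ ∃ e ∈ L i, (𝒟.denom : ℤ) • 𝒟.key i e.1 = v

theorem loaded_nil : 𝒟.Loaded (fun _ => []) fun _ => 0 where
  array h := absurd h.symm (by simp)
  mark := by simp

/-- The store `st` after the entry `e` has been added to the list of length `j` for direction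
`i`. -/
noncomputable def addEntry (i : Fin m) (j : ℤ) (e : (Fin d → ℤ) × ℕ) (st : List ℤ → ℤ) :
    List ℤ → ℤ :=
  Function.update (Function.extend (arrayCell (i : ℕ) j) e.1 st)
    (markCell i ((𝒟.denom : ℤ) • 𝒟.key i e.1)) 1

variable {𝒟} in
theorem Loaded.addEntry {L : Fin m → LineList d} {st : List ℤ → ℤ} (h : 𝒟.Loaded L st)
    (i : Fin m) (e : (Fin d → ℤ) × ℕ) :
    𝒟.Loaded (Function.update L i (L i ++ [e])) (𝒟.addEntry i (L i).length e st) where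
  array := by
    intro i' pre e' suf hL k
    rw [GridData.addEntry, Function.update_of_ne (markCell_ne_arrayCell _ _ _ _ _).symm]
    rcases eq_or_ne i' i with rfl | hi
    · rw [Function.update_self] at hL
      rcases suf.eq_nil_or_concat with rfl | ⟨suf, e'', rfl⟩
      · obtain ⟨rfl, he⟩ := List.append_inj' hL rfl
        rw [(arrayCell_injective _ _).extend_apply, List.singleton_inj.1 he]
      · rw [List.concat_eq_append, ← List.cons_append, ← List.append_assoc] at hL
        have hL' := List.append_inj_left' hL rfl
        rw [Function.extend_apply', h.array hL']
        exact fun ⟨k', hk'⟩ => arrayCell_ne (fun _ => by simp [hL']; lia) k' k hk'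
    · rw [Function.update_of_ne hi] at hL
      rw [Function.extend_apply', h.array hL]
      refine fun ⟨k', hk'⟩ => arrayCell_ne (fun hii => ?_) k' k hk'
      exact absurd (Fin.ext (Nat.cast_injective hii)).symm hi
  mark := by
    intro i' v
    by_cases hi : markCell i' v = markCell i ((𝒟.denom : ℤ) • 𝒟.key i e.1)
    · rw [GridData.addEntry, hi, Function.update_self]
      obtain ⟨rfl, rfl⟩ := markCell_inj.1 hi
      simp
    · rw [GridData.addEntry, Function.update_of_ne hi, Function.extend_apply', h.mark]
      · rcases eq_or_ne i' i with rfl | hi'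
        · have hv : (𝒟.denom : ℤ) • 𝒟.key i' e.1 ≠ v := fun h => hi (by rw [h])
          simp only [Function.update_self, List.mem_append, List.mem_singleton, or_and_right,
            exists_or, exists_eq_left, hv, or_false]
        · rw [Function.update_of_ne hi']
      · exact fun ⟨k, hk⟩ => markCell_ne_arrayCell _ _ _ _ _ hk.symm

section Reading

/-- Reading one entry for direction `i`. -/
def readEntry (i : Fin m) : Stmt (GridVar d m) :=
  .seq (.readVec .row) <|
  .seq (.read .value) <|
  .seq (.storeVec .row (i : ℕ) .outer) <|
  .seq (.store
    (markExpr i (linExpr ((𝒟.denom : ℤ) • 𝒟.key i) fun k => .var (.row k))) (.const 1)) <|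
  .set .outer (.plus (.var .outer) (.const 1))

/-- Reading the list for direction `i`. -/
def readList (i : Fin m) : Stmt (GridVar d m) :=
  .seq (.read (.length i)) <|
  .seq (.set .outer (.const 0)) <|
  .loop (.lt (.var .outer) (.var (.length i))) (𝒟.readEntry i)

/-- The part of the input tape for one entry. -/
def entryInput (e : (Fin d → ℤ) × ℕ) : List ℤ := List.ofFn e.1 ++ [(e.2 : ℤ)]

/-- The part of the input tape for one direction. -/
def listInput (l : LineList d) : List ℤ := (l.length : ℤ) :: l.flatMap entryInput

variable {Q : State (GridVar d m) → Prop} {σ : State (GridVar d m)} {L : Fin m → LineList d}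

theorem wp_readEntry (i : Fin m) (e : (Fin d → ℤ) × ℕ) (rest : List ℤ)
    (hinput : σ.input = entryInput e ++ rest)
    (hQ : ∀ f : GridVar d m → ℤ, f .outer = σ.vars .outer + 1 →
      (∀ i, f (.length i) = σ.vars (.length i)) →
      Q ⟨f, 𝒟.addEntry i (σ.vars .outer) e σ.store, rest, σ.output⟩) :
    (𝒟.readEntry i).wp S Q σ := by
  have hrow : Function.Injective (GridVar.row : Fin d → GridVar d m) := fun _ _ => GridVar.row.inj
  refine Stmt.wp_readVec hrow (e := e.1) (by rw [hinput, entryInput, List.append_assoc]) ?_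
  refine ⟨e.2, rest, rfl, Stmt.wp_storeVec _ _ ?_⟩
  set f := Function.update (Function.extend GridVar.row e.1 σ.vars) .value (e.2 : ℤ) with hf
  have hf_row (k : Fin d) : f (.row k) = e.1 k := by
    rw [hf, Function.update_of_ne (by simp), hrow.extend_apply]
  have hf_of_ne (v : GridVar d m) (hv : v ≠ .value) (hv' : ∀ k, .row k ≠ v) : f v = σ.vars v := by
    rw [hf, Function.update_of_ne hv, Function.extend_apply' _ _ _ (not_exists.2 hv')]
  have hf_outer : f .outer = σ.vars .outer := hf_of_ne _ nofun nofun
  simp only [Stmt.wp, State.set, State.setCell, map_eval_markExpr, eval_linExpr, PolyExpr.eval,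
    ← hf, hf_row, hf_outer]
  exact hQ _ (Function.update_self ..) fun i => by
    rw [Function.update_of_ne (by simp), hf_of_ne (.length i) nofun nofun]

theorem wp_readList (i : Fin m) (l : LineList d) (rest : List ℤ) (hS : l.length ≤ S)
    (hL : L i = []) (hinput : σ.input = listInput l ++ rest) (hloaded : 𝒟.Loaded L σ.store) :
    (𝒟.readList i).wp S (fun σ' => 𝒟.Loaded (Function.update L i l) σ'.store ∧
      σ'.vars (.length i) = l.length ∧ (∀ j ≠ i, σ'.vars (.length j) = σ.vars (.length j)) ∧
      σ'.input = rest ∧ σ'.output = σ.output) σ := by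
  refine ⟨l.length, l.flatMap entryInput ++ rest, hinput, ?_⟩
  refine Stmt.wp_loop l hS (fun pre suf σ' => 𝒟.Loaded (Function.update L i pre) σ'.store ∧
    σ'.vars .outer = pre.length ∧ σ'.vars (.length i) = l.length ∧
    (∀ j ≠ i, σ'.vars (.length j) = σ.vars (.length j)) ∧
    σ'.input = suf.flatMap entryInput ++ rest ∧ σ'.output = σ.output) ?_ ?_ ?_
  · refine ⟨by rwa [← hL, Function.update_eq_self], by simp [State.set, PolyExpr.eval], ?_, ?_,
      rfl, rfl⟩
    · simp [State.set]
    · intro j hj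
      simp [State.set, hj]
  · rintro pre e suf rfl σ' ⟨hloaded', houter, hlen, hlen', hinput', houtput⟩
    refine ⟨by simp [Guard.Holds, PolyExpr.eval, houter, hlen], ?_⟩
    refine 𝒟.wp_readEntry i e (suf.flatMap entryInput ++ rest) (by simpa using hinput')
      fun f hf hf' => ⟨?_, ?_, (hf' i).trans hlen, fun j hj => (hf' j).trans (hlen' j hj), rfl,
        houtput⟩
    · rw [houter]
      simpa using hloaded'.addEntry i e
    · simpa [houter] using hf
  · rintro σ' ⟨hloaded', houter, hlen, hlen', hinput', houtput⟩
    exact ⟨by simp [Guard.Holds, PolyExpr.eval, houter, hlen], hloaded', hlen, hlen', hinput',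
      houtput⟩

/-- The state `σ` holds the lists `L` and their lengths. -/
structure Ready (L : Fin m → LineList d) (σ : State (GridVar d m)) : Prop where
  loaded : 𝒟.Loaded L σ.store
  length : ∀ i, σ.vars (.length i) = (L i).length

theorem wp_readLists (hS : ∀ i, (L i).length ≤ S) :
    (Stmt.block 𝒟.readList (List.finRange m)).wp S (fun σ => 𝒟.Ready L σ ∧ σ.output = [])
      ⟨fun _ => 0, fun _ => 0, (List.finRange m).flatMap fun i => listInput (L i), []⟩ := by
  refine Stmt.wp_mono (Stmt.wp_block (List.finRange m) (fun pre suf σ =>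
    𝒟.Loaded (fun i => if i ∈ pre then L i else []) σ.store ∧
    (∀ i ∈ pre, σ.vars (.length i) = (L i).length) ∧
    σ.input = suf.flatMap (fun i => listInput (L i)) ∧ σ.output = []) ?_ ?_) ?_
  · exact ⟨by simpa using 𝒟.loaded_nil, by simp, rfl, rfl⟩
  · rintro pre i suf hl σ ⟨hloaded, hlen, hinput, houtput⟩
    have hi : i ∉ pre := fun h =>
      (List.nodup_append.1 (hl ▸ List.nodup_finRange m)).2.2 i h i List.mem_cons_self rfl
    refine Stmt.wp_mono (𝒟.wp_readList i (L i) _ (hS i) (if_neg hi) hinput hloaded) ?_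
    rintro σ' ⟨hloaded', hlen_i, hlen', hinput', houtput'⟩
    refine ⟨?_, fun j hj => ?_, hinput', houtput'.trans houtput⟩
    · convert hloaded' using 1
      funext j
      rcases eq_or_ne j i with rfl | hj <;> simp [*]
    · rcases eq_or_ne j i with rfl | hji
      · exact hlen_i
      · rw [hlen' j hji, hlen j (by simpa [hji] using hj)]
  · rintro σ ⟨hloaded, hlen, -, houtput⟩
    exact ⟨⟨by simpa using hloaded, fun i => hlen i (List.mem_finRange i)⟩, houtput⟩

end Reading

variable {L : Fin m → LineList d} {Q : State (GridVar d m) → Prop} {σ : State (GridVar d m)}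

section Scanning

/-- The statement `a` for all lines in the list for direction `i`, with the index of the line in
the variable `j` and its vector in the variables `x`. -/
def forEach (i : Fin m) (j : GridVar d m) (x : Fin d → GridVar d m) (a : Stmt (GridVar d m)) :
    Stmt (GridVar d m) :=
  .seq (.set j (.const 0)) <|
  .loop (.lt (.var j) (.var (.length i))) <|
  .seq (.loadVec x (i : ℕ) j) <| .seq a <| .set j (.plus (.var j) (.const 1))

theorem wp_forEach (hS : ∀ i, (L i).length ≤ S) {i : Fin m} {j : GridVar d m}
    {x : Fin d → GridVar d m} {a : Stmt (GridVar d m)} (hx : Function.Injective x)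
    (hj : ∀ k, x k ≠ j) (I : LineList d → State (GridVar d m) → Prop)
    (hready : ∀ pre σ, I pre σ → 𝒟.Ready L σ) (hstart : I [] (σ.set j 0))
    (hstep : ∀ pre e σ, I pre σ → σ.vars j = pre.length →
      a.wp S (fun σ' => σ'.vars j = pre.length ∧ I (pre ++ [e]) (σ'.set j (pre.length + 1)))
        { σ with vars := Function.extend x e.1 σ.vars })
    (hend : ∀ σ, I (L i) σ → Q σ) : (forEach i j x a).wp S Q σ := by
  refine Stmt.wp_loop (L i) (hS i) (fun pre _ σ => σ.vars j = pre.length ∧ I pre σ) ?_ ?_ ?_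
  · exact ⟨by simp [State.set, PolyExpr.eval], hstart⟩
  · rintro pre e suf hL σ ⟨hpre, hI⟩
    refine ⟨by simp [Guard.Holds, PolyExpr.eval, hpre, (hready _ _ hI).length, hL], ?_⟩
    refine Stmt.wp_loadVec hx hj (hpre ▸ (hready _ _ hI).loaded.array hL)
      (Stmt.wp_seq (hstep pre e σ hI hpre) ?_)
    rintro σ' ⟨hpre', hI'⟩
    simp only [Stmt.wp, PolyExpr.eval, hpre']
    exact ⟨by simp [State.set], hI'⟩
  · rintro σ ⟨hpre, hI⟩
    exact ⟨by simp [Guard.Holds, PolyExpr.eval, hpre, (hready _ _ hI).length], hend σ hI⟩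

/-- The statement `a` for all pairs of lines with the directions `i₀` and `i₁`. -/
def scan (a : Stmt (GridVar d m)) : Stmt (GridVar d m) :=
  forEach 𝒟.i₀ .outer .row (forEach 𝒟.i₁ .inner .col a)

/-- `denom` times the coordinates of the point where two lines meet. -/
def meet (x y : (Fin d → ℤ) × ℕ) : Fin d → ℤ := 𝒟.fst x.1 + 𝒟.snd y.1

/-- `denom` times the coordinates of the points where a line with direction `i₀` meets a line with
direction `i₁`. -/
def meets (L : Fin m → LineList d) : List (Fin d → ℤ) :=
  (L 𝒟.i₀).flatMap fun x => (L 𝒟.i₁).map (𝒟.meet x)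

/-- The expressions for the point where the current lines meet. -/
def meetExpr (k : Fin d) : PolyExpr (GridVar d m) :=
  .plus (linExpr 𝒟.fst (fun k => .var (.row k)) k) (linExpr 𝒟.snd (fun k => .var (.col k)) k)

/-- The current lines in the state `σ` meet in the point with the coordinates `w / denom`. -/
def MeetAt (w : Fin d → ℤ) (σ : State (GridVar d m)) : Prop :=
  ∀ k, (𝒟.meetExpr k).eval σ.vars = w k

theorem meetAt_meet {x y : (Fin d → ℤ) × ℕ} (hx : ∀ k, σ.vars (.row k) = x.1 k)
    (hy : ∀ k, σ.vars (.col k) = y.1 k) : 𝒟.MeetAt (𝒟.meet x y) σ := by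
  intro k
  simp only [meetExpr, meet, PolyExpr.eval, eval_linExpr, hx, hy, Pi.add_apply]

/-- In the state `σ`, which holds the lists `L`, the counters have the values `c` and `t`, and the
output is `out`. -/
structure Progress (L : Fin m → LineList d) (c t : ℤ) (out : List ℚ) (σ : State (GridVar d m)) :
    Prop extends 𝒟.Ready L σ where
  count : σ.vars .count = c
  classes : σ.vars .classes = t
  output : σ.output = out

/-- The state after increasing the point counter by `c` and writing `out`. -/
def advance (σ : State (GridVar d m)) (c : ℤ) (out : List ℚ) : State (GridVar d m) :=
  { σ.set .count (σ.vars .count + c) with output := σ.output ++ out }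

namespace Progress

variable {𝒟} {c t : ℤ} {out : List ℚ}

theorem withVars (h : 𝒟.Progress L c t out σ) {f : GridVar d m → ℤ}
    (hlength : ∀ i, f (.length i) = σ.vars (.length i)) (hcount : f .count = σ.vars .count)
    (hclasses : f .classes = σ.vars .classes) : 𝒟.Progress L c t out { σ with vars := f } where
  loaded := h.loaded
  length i := (hlength i).trans (h.length i)
  count := hcount.trans h.count
  classes := hclasses.trans h.classes
  output := h.output

theorem set (h : 𝒟.Progress L c t out σ) {v : GridVar d m} (z : ℤ) (hlength : ∀ i, .length i ≠ v)
    (hcount : .count ≠ v) (hclasses : .classes ≠ v) : 𝒟.Progress L c t out (σ.set v z) :=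
  h.withVars (fun i => Function.update_of_ne (hlength i) ..) (Function.update_of_ne hcount ..)
    (Function.update_of_ne hclasses ..)

theorem setCount (h : 𝒟.Progress L c t out σ) (z : ℤ) :
    𝒟.Progress L z t out (σ.set .count z) where
  loaded := h.loaded
  length i := by simpa [State.set] using h.length i
  count := by simp [State.set]
  classes := by simpa [State.set] using h.classes
  output := h.output

theorem setClasses (h : 𝒟.Progress L c t out σ) (z : ℤ) :
    𝒟.Progress L c z out (σ.set .classes z) where
  loaded := h.loaded
  length i := by simpa [State.set] using h.length i
  count := by simpa [State.set] using h.count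
  classes := by simp [State.set]
  output := h.output

theorem write (h : 𝒟.Progress L c t out σ) (out' : List ℚ) :
    𝒟.Progress L c t (out ++ out') { σ with output := σ.output ++ out' } :=
  { h with output := by rw [h.output] }

theorem advance (h : 𝒟.Progress L c t out σ) (c' : ℤ) (out' : List ℚ) :
    𝒟.Progress L (c + c') t (out ++ out') (advance σ c' out') :=
  h.count ▸ (h.setCount _).write out'

end Progress

section

variable {a : Stmt (GridVar d m)} {c : (Fin d → ℤ) → ℤ} {o : (Fin d → ℤ) → List ℚ}
  {c₀ t : ℤ} {out : List ℚ}

theorem wp_scan_inner (hS : ∀ i, (L i).length ≤ S)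
    (ha : ∀ w σ, 𝒟.Ready L σ → 𝒟.MeetAt w σ → a.wp S (· = advance σ (c w) (o w)) σ)
    (x : (Fin d → ℤ) × ℕ) (hx : ∀ k, σ.vars (.row k) = x.1 k) (hσ : 𝒟.Progress L c₀ t out σ) :
    (forEach 𝒟.i₁ .inner .col a).wp S (fun σ' => σ'.vars .outer = σ.vars .outer ∧
      𝒟.Progress L (c₀ + (((L 𝒟.i₁).map (𝒟.meet x)).map c).sum) t
        (out ++ ((L 𝒟.i₁).map (𝒟.meet x)).flatMap o) σ') σ := by
  have hcol : Function.Injective (GridVar.col : Fin d → GridVar d m) := fun _ _ => GridVar.col.inj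
  refine 𝒟.wp_forEach hS hcol nofun (fun pre σ' => (∀ k, σ'.vars (.row k) = x.1 k) ∧
    σ'.vars .outer = σ.vars .outer ∧ 𝒟.Progress L (c₀ + ((pre.map (𝒟.meet x)).map c).sum) t
      (out ++ (pre.map (𝒟.meet x)).flatMap o) σ')
    (fun _ _ h => h.2.2.toReady) ?_ ?_ fun _ h => h.2
  · refine ⟨by simpa [State.set] using hx, by simp [State.set], ?_⟩
    simpa using hσ.set (v := .inner) 0 nofun nofun nofun
  · rintro pre y σ₁ ⟨hrow, houter, h⟩ hinner
    have hext {v : GridVar d m} (hv : ∀ k, .col k ≠ v) :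
        Function.extend GridVar.col y.1 σ₁.vars v = σ₁.vars v :=
      Function.extend_apply' _ _ _ (not_exists.2 hv)
    have h₂ := h.withVars (f := Function.extend .col y.1 σ₁.vars) (fun _ => hext nofun)
      (hext nofun) (hext nofun)
    refine Stmt.wp_mono (ha (𝒟.meet x y) _ h₂.toReady (𝒟.meetAt_meet
      (fun k => (hext (v := .row k) nofun).trans (hrow k)) fun k => hcol.extend_apply _ _ k)) ?_
    rintro _ rfl
    have h₃ := h₂.advance (c (𝒟.meet x y)) (o (𝒟.meet x y))
    refine ⟨by simpa [advance, State.set, hext] using hinner,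
      by simpa [advance, State.set, hext] using hrow,
      by simpa [advance, State.set, hext] using houter, ?_⟩
    simpa [add_assoc] using h₃.set (v := .inner) (pre.length + 1) nofun nofun nofun

theorem wp_scan (hS : ∀ i, (L i).length ≤ S)
    (ha : ∀ w σ, 𝒟.Ready L σ → 𝒟.MeetAt w σ → a.wp S (· = advance σ (c w) (o w)) σ)
    (hσ : 𝒟.Progress L c₀ t out σ) :
    (𝒟.scan a).wp S (𝒟.Progress L (c₀ + ((𝒟.meets L).map c).sum) t
      (out ++ (𝒟.meets L).flatMap o)) σ := by
  have hrow : Function.Injective (GridVar.row : Fin d → GridVar d m) := fun _ _ => GridVar.row.inj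
  let meetsOf (l : LineList d) := l.flatMap fun x => (L 𝒟.i₁).map (𝒟.meet x)
  refine 𝒟.wp_forEach hS hrow nofun (fun pre => 𝒟.Progress L
    (c₀ + ((meetsOf pre).map c).sum) t (out ++ (meetsOf pre).flatMap o))
    (fun _ _ h => h.toReady) ?_ ?_ fun _ h => h
  · simpa [meetsOf] using hσ.set (v := .outer) 0 nofun nofun nofun
  · intro pre x σ₁ h houter
    have hext {v : GridVar d m} (hv : ∀ k, .row k ≠ v) :
        Function.extend GridVar.row x.1 σ₁.vars v = σ₁.vars v :=
      Function.extend_apply' _ _ _ (not_exists.2 hv)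
    have h₂ := h.withVars (f := Function.extend .row x.1 σ₁.vars) (fun _ => hext nofun)
      (hext nofun) (hext nofun)
    refine Stmt.wp_mono (𝒟.wp_scan_inner hS ha x (fun k => hrow.extend_apply _ _ k) h₂) ?_
    rintro σ₃ ⟨houter₃, h₃⟩
    refine ⟨houter₃.trans ((hext (v := .outer) nofun).trans houter), ?_⟩
    simpa [meetsOf, add_assoc] using h₃.set (v := .outer) (pre.length + 1) nofun nofun nofun

end

end Scanning

section Points

/-- The vector `w / denom` is congruent to `v / denom` modulo the integral vectors, and it lies on
a line from each of the lists `L`. -/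
def Accepts (L : Fin m → LineList d) (v w : Fin d → ℤ) : Prop :=
  (∀ i, ∃ e ∈ L i, (𝒟.denom : ℤ) • 𝒟.key i e.1 = 𝒟.key i w) ∧
    ∀ k, ∃ z : ℤ, ((w k - v k : ℤ) : ℚ) * (1 / 𝒟.denom) = z

/-- The tests for `CycloTomo.GridData.Accepts` at the point where the current lines meet. -/
def guards (v : Fin d → ℤ) : List (Guard (GridVar d m)) :=
  ((List.finRange m).map fun i => .pos (markExpr i (linExpr (𝒟.key i) 𝒟.meetExpr))) ++
    (List.finRange d).map fun k => .int (.plus (𝒟.meetExpr k) (.const (-v k))) (1 / 𝒟.denom)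

theorem forall_guards_holds_iff (v : Fin d → ℤ) {w : Fin d → ℤ} (hσ : 𝒟.Ready L σ)
    (hw : 𝒟.MeetAt w σ) : (∀ g ∈ 𝒟.guards v, g.Holds σ) ↔ 𝒟.Accepts L v w := by
  have hw' (k : Fin d) : (𝒟.meetExpr k).eval σ.vars = w k := hw k
  simp only [guards, List.mem_append, or_imp, forall_and, List.forall_mem_map, List.mem_finRange,
    forall_const, Guard.Holds, map_eval_markExpr, hσ.loaded.mark, Accepts, PolyExpr.eval, hw',
    eval_linExpr, sub_eq_add_neg]

/-- The vector `w / denom`. -/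
def point (w : Fin d → ℤ) : Fin d → ℚ := fun k => w k * (1 / 𝒟.denom)

open Classical in
/-- The points of the grid which are congruent to `v / denom` modulo the integral vectors. -/
noncomputable def points (L : Fin m → LineList d) (v : Fin d → ℤ) : List (Fin d → ℚ) :=
  ((𝒟.meets L).filter (𝒟.Accepts L v)).map 𝒟.point

/-- The statement `a` for all pairs of lines which meet in one of the `points` for `v`. -/
def visit (v : Fin d → ℤ) (a : Stmt (GridVar d m)) : Stmt (GridVar d m) :=
  𝒟.scan (.guarded a (𝒟.guards v))

theorem sum_map_ite {α : Type*} (p : α → Prop) [DecidablePred p] (c : ℤ) (l : List α) :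
    (l.map fun a => if p a then c else 0).sum = (l.filter p).length * c := by
  induction l with
  | nil => simp
  | cons a l ih =>
    by_cases h : p a
    · simp [h, ih, add_mul, add_comm]
    · simp [h, ih]

theorem flatMap_ite {α β : Type*} (p : α → Prop) [DecidablePred p] (f : α → List β) (l : List α) :
    (l.flatMap fun a => if p a then f a else []) = (l.filter p).flatMap f := by
  induction l with
  | nil => rfl
  | cons a l ih => by_cases h : p a <;> simp [h, ih]

@[simp]
theorem advance_zero_nil (σ : State (GridVar d m)) : advance σ 0 [] = σ := by
  simp [advance, State.set]

variable {c c₀ t : ℤ} {out : List ℚ}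

theorem wp_visit (hS : ∀ i, (L i).length ≤ S) (v : Fin d → ℤ) {a : Stmt (GridVar d m)}
    {o : (Fin d → ℚ) → List ℚ}
    (ha : ∀ w σ, 𝒟.MeetAt w σ → a.wp S (· = advance σ c (o (𝒟.point w))) σ)
    (hσ : 𝒟.Progress L c₀ t out σ) :
    (𝒟.visit v a).wp S (𝒟.Progress L (c₀ + (𝒟.points L v).length * c) t
      (out ++ (𝒟.points L v).flatMap o)) σ := by
  classical
  rw [points, List.length_map, List.flatMap_map, ← sum_map_ite, ← flatMap_ite]
  refine 𝒟.wp_scan hS (fun w σ hready hmeet => ?_) hσ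
  refine Stmt.wp_guarded _ ?_ ?_ <;> rw [𝒟.forall_guards_holds_iff v hready hmeet] <;> intro h
  · simpa only [if_pos h] using ha w σ hmeet
  · simp only [if_neg h, advance_zero_nil]

/-- Counting the `points` for `v`. -/
def countPoints (v : Fin d → ℤ) : Stmt (GridVar d m) :=
  .seq (.set .count (.const 0)) <| 𝒟.visit v <| .set .count (.plus (.var .count) (.const 1))

/-- Writing the `points` for `v`. -/
def writePoints (v : Fin d → ℤ) : Stmt (GridVar d m) :=
  𝒟.visit v <| .writeVec 𝒟.meetExpr (1 / 𝒟.denom)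

theorem wp_countPoints (hS : ∀ i, (L i).length ≤ S) (v : Fin d → ℤ)
    (hσ : 𝒟.Progress L c t out σ) :
    (𝒟.countPoints v).wp S (𝒟.Progress L (𝒟.points L v).length t out) σ := by
  have h := 𝒟.wp_visit hS v (c := 1) (o := fun _ => [])
    (a := .set .count (.plus (.var .count) (.const 1)))
    (fun w σ _ => by simp [Stmt.wp, advance, State.set, PolyExpr.eval]) (hσ.setCount 0)
  have hnil : (𝒟.points L v).flatMap (fun _ => ([] : List ℚ)) = [] := by simp
  simpa [countPoints, Stmt.wp, PolyExpr.eval, hnil] using h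

theorem wp_writePoints (hS : ∀ i, (L i).length ≤ S) (v : Fin d → ℤ)
    (hσ : 𝒟.Progress L c t out σ) :
    (𝒟.writePoints v).wp S (𝒟.Progress L c t (out ++ (𝒟.points L v).flatMap List.ofFn)) σ := by
  have h := 𝒟.wp_visit hS v (c := 0) (o := List.ofFn) (a := .writeVec 𝒟.meetExpr (1 / 𝒟.denom))
    (fun w σ hw => Stmt.wp_writeVec _ _ (by
      have hw' (k : Fin d) : (𝒟.meetExpr k).eval σ.vars = w k := hw k
      simp only [hw', advance, State.set, add_zero, Function.update_eq_self]
      rfl)) hσ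
  simpa only [writePoints, mul_zero, add_zero] using h

/-- The statement `a` if there are `points` for `v`, after counting them. -/
def ifPoints (v : Fin d → ℤ) (a : Stmt (GridVar d m)) : Stmt (GridVar d m) :=
  .seq (𝒟.countPoints v) (.cond (.lt (.const 0) (.var .count)) a)

theorem wp_ifPoints (hS : ∀ i, (L i).length ≤ S) (v : Fin d → ℤ) {a : Stmt (GridVar d m)}
    (hσ : 𝒟.Progress L c t out σ)
    (hnil : ∀ σ, 𝒟.points L v = [] → 𝒟.Progress L 0 t out σ → Q σ)
    (ha : ∀ σ, 𝒟.points L v ≠ [] → 𝒟.Progress L (𝒟.points L v).length t out σ → a.wp S Q σ) :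
    (𝒟.ifPoints v a).wp S Q σ := by
  refine Stmt.wp_seq (𝒟.wp_countPoints hS v hσ) fun σ h => ?_
  have hpos : (Guard.lt (.const 0) (.var .count)).Holds σ ↔ 𝒟.points L v ≠ [] := by
    simp [Guard.Holds, PolyExpr.eval, h.count, List.length_pos_iff]
  rw [Stmt.wp, hpos]
  split_ifs with hv
  · exact ha σ hv h
  · rw [not_not] at hv
    exact hnil σ hv (by simpa [hv] using h)

end Points

section Program

open Classical in
/-- The nonempty lists of `points` for the vectors in the list `R`. -/
noncomputable def classes (L : Fin m → LineList d) (R : List (Fin d → ℤ)) :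
    List (List (Fin d → ℚ)) :=
  (R.map (𝒟.points L)).filter (· ≠ [])

/-- Counting the `classes` for `R`. -/
def countClasses (R : List (Fin d → ℤ)) : Stmt (GridVar d m) :=
  .seq (.set .classes (.const 0)) <|
  .block (fun v => 𝒟.ifPoints v <| .set .classes (.plus (.var .classes) (.const 1))) R

/-- Writing the `classes` for `R`. -/
def writeClasses (R : List (Fin d → ℤ)) : Stmt (GridVar d m) :=
  .block (fun v => 𝒟.ifPoints v <| .seq (.write (.var .count) 1) <| 𝒟.writePoints v) R

/-- The program for the grid; `R` represents the classes of vectors modulo `denom`. As the length of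
a list stands in front of its members on the output tape, everything is counted before it is
written. -/
def program (R : List (Fin d → ℤ)) : Stmt (GridVar d m) :=
  .seq (.block 𝒟.readList (List.finRange m)) <|
  .seq (𝒟.countClasses R) <|
  .seq (.write (.var .classes) 1) <|
  𝒟.writeClasses R

/-- The part of the output tape for a list of points. -/
def pointsOutput (l : List (Fin d → ℚ)) : List ℚ := (l.length : ℚ) :: l.flatMap List.ofFn

/-- The output tape for a list of lists of points. -/
def tape (Q : List (List (Fin d → ℚ))) : List ℚ := (Q.length : ℚ) :: Q.flatMap pointsOutput

variable {c t : ℤ} {out : List ℚ}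

theorem wp_countClasses (hS : ∀ i, (L i).length ≤ S) (R : List (Fin d → ℤ))
    (hσ : 𝒟.Progress L c t out σ) :
    (𝒟.countClasses R).wp S (fun σ => ∃ c, 𝒟.Progress L c (𝒟.classes L R).length out σ) σ := by
  refine Stmt.wp_block R (fun pre _ σ => ∃ c, 𝒟.Progress L c (𝒟.classes L pre).length out σ)
    ⟨c, by simpa [classes, PolyExpr.eval] using hσ.setClasses 0⟩ ?_
  rintro pre v suf - σ ⟨c, h⟩
  refine 𝒟.wp_ifPoints hS v h (fun σ hv h => ⟨0, by simpa [classes, hv] using h⟩)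
    fun σ hv h => ⟨(𝒟.points L v).length, ?_⟩
  simpa [Stmt.wp, PolyExpr.eval, h.classes, classes, hv] using
    h.setClasses ((𝒟.classes L pre).length + 1)

theorem wp_writeClasses (hS : ∀ i, (L i).length ≤ S) (R : List (Fin d → ℤ))
    (hσ : 𝒟.Progress L c t out σ) :
    (𝒟.writeClasses R).wp S (fun σ => σ.output = out ++ (𝒟.classes L R).flatMap pointsOutput)
      σ := by
  refine Stmt.wp_mono (Stmt.wp_block R (fun pre _ σ =>
    ∃ c, 𝒟.Progress L c t (out ++ (𝒟.classes L pre).flatMap pointsOutput) σ)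
    ⟨c, by simpa [classes] using hσ⟩ ?_) fun σ ⟨_, h⟩ => h.output
  rintro pre v suf - σ ⟨c, h⟩
  refine 𝒟.wp_ifPoints hS v h (fun σ hv h => ⟨0, by simpa [classes, hv] using h⟩)
    fun σ hv h => ?_
  refine Stmt.wp_mono (𝒟.wp_writePoints hS v (h.write _)) fun σ' h' =>
    ⟨(𝒟.points L v).length, ?_⟩
  simpa [classes, hv, pointsOutput, PolyExpr.eval, h.count] using h'

theorem wp_program (hS : ∀ i, (L i).length ≤ S) (R : List (Fin d → ℤ)) :
    (𝒟.program R).wp S (fun σ => σ.output = tape (𝒟.classes L R))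
      ⟨fun _ => 0, fun _ => 0, (List.finRange m).flatMap fun i => listInput (L i), []⟩ := by
  refine Stmt.wp_seq (𝒟.wp_readLists hS) fun σ ⟨hready, hout⟩ => ?_
  refine Stmt.wp_seq (𝒟.wp_countClasses hS R ⟨hready, rfl, rfl, hout⟩) fun σ ⟨c, h⟩ => ?_
  have hout' := 𝒟.wp_writeClasses hS R (h.write [((𝒟.classes L R).length : ℚ)])
  simpa [Stmt.wp, h.classes, PolyExpr.eval, tape] using hout'

end Program

section Cost

open Stmt (CostBound)

theorem costBound_forEach {i : Fin m} {j : GridVar d m} {x : Fin d → GridVar d m}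
    {a : Stmt (GridVar d m)} {k : ℕ} (ha : CostBound a k) :
    CostBound (forEach i j x a) (k + 1) :=
  .seq (.of_const (fun _ => rfl) _) <| .loop
    (.seq (.block (fun _ => .of_const (fun _ => rfl) _) _) <|
      .seq ha <| .of_const (fun _ => rfl) _) _

theorem costBound_visit (v : Fin d → ℤ) {a : Stmt (GridVar d m)} (ha : CostBound a 0) :
    CostBound (𝒟.visit v a) 2 :=
  costBound_forEach <| costBound_forEach <| ha.guarded _

theorem costBound_ifPoints (v : Fin d → ℤ) {a : Stmt (GridVar d m)} (ha : CostBound a 2) :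
    CostBound (𝒟.ifPoints v a) 2 :=
  .seq (.seq (.of_const (fun _ => rfl) _) <| 𝒟.costBound_visit v <| .of_const (fun _ => rfl) _) <|
    ha.cond _

theorem costBound_readList (i : Fin m) : CostBound (𝒟.readList i) 2 :=
  .seq (.of_const (fun _ => rfl) _) <| .seq (.of_const (fun _ => rfl) _) <| .loop
    (.seq (.block (fun _ => .of_const (fun _ => rfl) _) _) <| .seq (.of_const (fun _ => rfl) _) <|
      .seq (.block (fun _ => .of_const (fun _ => rfl) _) _) <|
      .seq (.of_const (fun _ => rfl) _) <| .of_const (fun _ => rfl) _) _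

theorem costBound_program (R : List (Fin d → ℤ)) : CostBound (𝒟.program R) 2 :=
  .seq (.block 𝒟.costBound_readList _) <|
  .seq (.seq (.of_const (fun _ => rfl) _) <|
    .block (fun v => 𝒟.costBound_ifPoints v <| .of_const (fun _ => rfl) _) _) <|
  .seq (.of_const (fun _ => rfl) _) <|
  .block (fun v => 𝒟.costBound_ifPoints v <| .seq (.of_const (fun _ => rfl) _) <|
    𝒟.costBound_visit v <| .block (fun _ => .of_const (fun _ => rfl) _) _) _

end Cost

end GridData

open ComplexConjugate Polynomial

section Coordinates

variable {n : ℕ} {ζ : ℂ}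

theorem linearIndependent_primitiveRoot_pow {K : Type*} [Field K] [CharZero K] {ζ : K}
    (hn : 0 < n) (hζ : IsPrimitiveRoot ζ n) :
    LinearIndependent ℚ fun k : Fin (Nat.totient n) => ζ ^ (k : ℕ) := by
  have hdeg : (minpoly ℚ ζ).natDegree = Nat.totient n := by
    rw [← cyclotomic_eq_minpoly_rat hζ hn, natDegree_cyclotomic]
  exact hdeg ▸ linearIndependent_pow (K := ℚ) ζ

theorem ofCoords_injective (hn : 0 < n) (hζ : IsPrimitiveRoot ζ n) :
    Function.Injective (ofCoords (n := n) ζ) := by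
  intro q q' h
  have hindep := linearIndependent_primitiveRoot_pow hn hζ
  have hzero := Fintype.linearIndependent_iff.1 hindep (q - q') (by
    simpa only [ofCoords, Pi.sub_apply, Algebra.smul_def, eq_ratCast, Rat.cast_sub, sub_mul,
      Finset.sum_sub_distrib, sub_eq_zero] using h)
  funext k
  exact sub_eq_zero.1 (hzero k)

/-- The number `v₀ + v₁ ζ + ⋯ + v_{φ(n)-1} ζ^{φ(n)-1}` with given integer coordinates, as a linear
map. -/
noncomputable def ofIntCoords (n : ℕ) (ζ : ℂ) : (Fin (Nat.totient n) → ℤ) →ₗ[ℤ] ℂ :=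
  Fintype.linearCombination ℤ fun k => ζ ^ (k : ℕ)

theorem ofCoords_intCast (v : Fin (Nat.totient n) → ℤ) :
    ofCoords ζ (fun k => (v k : ℚ)) = ofIntCoords n ζ v := by
  simp [ofCoords, ofIntCoords, Fintype.linearCombination_apply]

theorem ofCoords_mul (v : Fin (Nat.totient n) → ℤ) (q : ℚ) :
    ofCoords ζ (fun k => (v k : ℚ) * q) = ofIntCoords n ζ v * q := by
  rw [← ofCoords_intCast, ofCoords, ofCoords, Finset.sum_mul]
  exact Finset.sum_congr rfl fun k _ => by rw [Rat.cast_mul, mul_right_comm]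

theorem ofIntCoords_injective (hn : 0 < n) (hζ : IsPrimitiveRoot ζ n) :
    Function.Injective (ofIntCoords n ζ) := by
  intro v v' h
  rw [← ofCoords_intCast, ← ofCoords_intCast] at h
  funext k
  exact_mod_cast congrFun (ofCoords_injective hn hζ h) k

theorem self_mem_moduleO : ζ ∈ moduleO ζ := Algebra.self_mem_adjoin_singleton ℤ ζ

theorem ofIntCoords_mem_moduleO (v : Fin (Nat.totient n) → ℤ) : ofIntCoords n ζ v ∈ moduleO ζ := by
  rw [ofIntCoords, Fintype.linearCombination_apply]
  exact sum_mem fun k _ => zsmul_mem (pow_mem self_mem_moduleO _) _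

theorem exists_ofIntCoords_eq (hn : 0 < n) (hζ : IsPrimitiveRoot ζ n) {z : ℂ}
    (hz : z ∈ moduleO ζ) : ∃ v, ofIntCoords n ζ v = z := by
  rw [moduleO, Algebra.adjoin_singleton_eq_range_aeval] at hz
  obtain ⟨p, rfl⟩ := hz
  change ∃ v, _ = aeval ζ p
  have hroot : aeval ζ (cyclotomic n ℤ) = 0 := by
    rw [aeval_def, eval₂_eq_eval_map, map_cyclotomic]
    exact hζ.isRoot_cyclotomic hn
  have hdeg : (p %ₘ cyclotomic n ℤ).natDegree < Nat.totient n := by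
    rw [← natDegree_cyclotomic n ℤ]
    refine natDegree_modByMonic_lt _ (cyclotomic.monic n ℤ) fun h => ?_
    exact (Nat.totient_pos.2 hn).ne (by rw [← natDegree_cyclotomic n ℤ, h, natDegree_one])
  refine ⟨fun k => (p %ₘ cyclotomic n ℤ).coeff k, ?_⟩
  rw [← aeval_modByMonic_eq_self_of_root hroot, aeval_eq_sum_range' hdeg,
    ← Fin.sum_univ_eq_sum_range (fun k => (p %ₘ cyclotomic n ℤ).coeff k • ζ ^ k), ofIntCoords,
    Fintype.linearCombination_apply]

theorem mem_moduleO_iff (hn : 0 < n) (hζ : IsPrimitiveRoot ζ n) {z : ℂ} :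
    z ∈ moduleO ζ ↔ ∃ v, ofIntCoords n ζ v = z :=
  ⟨exists_ofIntCoords_eq hn hζ, fun ⟨v, hv⟩ => hv ▸ ofIntCoords_mem_moduleO v⟩

theorem ofCoords_mem_moduleO_iff (hn : 0 < n) (hζ : IsPrimitiveRoot ζ n)
    (q : Fin (Nat.totient n) → ℚ) :
    ofCoords ζ q ∈ moduleO ζ ↔ ∀ k, ∃ z : ℤ, q k = (z : ℚ) := by
  simp only [mem_moduleO_iff hn hζ, ← ofCoords_intCast, (ofCoords_injective hn hζ).eq_iff,
    funext_iff, eq_comm (b := q _), Classical.skolem]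

theorem exists_linearMap_ofIntCoords (hn : 0 < n) (hζ : IsPrimitiveRoot ζ n) (G : ℂ →+ ℂ)
    (hG : ∀ z ∈ moduleO ζ, G z ∈ moduleO ζ) :
    ∃ F : (Fin (Nat.totient n) → ℤ) →ₗ[ℤ] (Fin (Nat.totient n) → ℤ),
      ∀ v, ofIntCoords n ζ (F v) = G (ofIntCoords n ζ v) := by
  let e := LinearEquiv.ofInjective (ofIntCoords n ζ) (ofIntCoords_injective hn hζ)
  have hrange (v) : (G.toIntLinearMap ∘ₗ ofIntCoords n ζ) v ∈ LinearMap.range (ofIntCoords n ζ) :=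
    exists_ofIntCoords_eq hn hζ (hG _ (ofIntCoords_mem_moduleO v))
  exact ⟨e.symm.toLinearMap ∘ₗ LinearMap.codRestrict _ _ hrange, fun v =>
    congrArg Subtype.val (e.apply_symm_apply (LinearMap.codRestrict _ _ hrange v))⟩

theorem conj_mem_moduleO (hn : 0 < n) (hζ : IsPrimitiveRoot ζ n) {z : ℂ} (hz : z ∈ moduleO ζ) :
    conj z ∈ moduleO ζ := by
  have hconj : conj ζ = ζ ^ (n - 1) := by
    rw [← Complex.inv_eq_conj (hζ.norm'_eq_one hn.ne'), inv_eq_iff_eq_inv]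
    exact eq_inv_of_mul_eq_one_right (by rw [← pow_succ, Nat.sub_add_cancel hn, hζ.pow_eq_one])
  have hle : moduleO ζ ≤ (moduleO ζ).comap (Complex.conjAe.toAlgHom.restrictScalars ℤ) :=
    Algebra.adjoin_singleton_le
      (show conj ζ ∈ moduleO ζ from hconj ▸ pow_mem self_mem_moduleO _)
  exact hle hz

theorem exists_mul_eq_natCast (hn : 0 < n) (hζ : IsPrimitiveRoot ζ n) {D : ℂ}
    (hD : D ∈ moduleO ζ) (hD₀ : D ≠ 0) : ∃ E ∈ moduleO ζ, ∃ N : ℕ, 0 < N ∧ D * E = N := by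
  have hintegral : IsIntegral ℤ (⟨D, hD⟩ : moduleO ζ) :=
    (isIntegral_algHom_iff (moduleO ζ).val Subtype.val_injective).1
      (adjoin_le_integralClosure (hζ.isIntegral hn) hD)
  obtain ⟨r, hr, E, hE⟩ := hintegral.isAlgebraic.exists_nonzero_dvd
    (mem_nonZeroDivisors_of_ne_zero fun h => hD₀ (congrArg Subtype.val h))
  have hE' : (r : ℂ) = D * E := by simpa using congrArg Subtype.val hE
  obtain ⟨s, hs⟩ : r ∣ (r.natAbs : ℤ) := Int.dvd_natAbs_self
  refine ⟨E * s, mul_mem E.2 (intCast_mem _ s), r.natAbs, Int.natAbs_pos.2 hr, ?_⟩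
  rw [← mul_assoc, ← hE', ← Int.cast_mul, ← hs, Int.cast_natCast]

end Coordinates

section Lines

variable {o o' t t' z z' : ℂ}

/-- The real linear map `z ↦ z ō - z̄ o`, whose fibres are the lines with direction `o ≠ 0`. -/
noncomputable def lineInvariant (o : ℂ) : ℂ →ₗ[ℝ] ℂ :=
  LinearMap.mulRight ℝ (conj o) - LinearMap.mulRight ℝ o ∘ₗ Complex.conjAe.toLinearMap

theorem lineInvariant_apply (o z : ℂ) : lineInvariant o z = z * conj o - conj z * o := rfl

theorem lineInvariant_eq_zero_iff (ho : o ≠ 0) : lineInvariant o z = 0 ↔ ∃ r : ℝ, r * o = z := by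
  have hconj : conj (z / o) = z / o ↔ lineInvariant o z = 0 := by
    rw [map_div₀, div_eq_div_iff (by simpa using ho) ho, lineInvariant_apply, sub_eq_zero, eq_comm]
  rw [← hconj, Complex.conj_eq_iff_real]
  exact exists_congr fun r => by rw [div_eq_iff ho, eq_comm]

theorem mem_lineSet_iff (ho : o ≠ 0) :
    z ∈ lineSet t o ↔ lineInvariant o z = lineInvariant o t := by
  rw [← sub_eq_zero, ← map_sub, lineInvariant_eq_zero_iff ho]
  exact exists_congr fun r => by rw [eq_sub_iff_add_eq', eq_comm]

theorem lineSet_eq_iff (ho : o ≠ 0) :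
    lineSet t o = lineSet t' o ↔ lineInvariant o t = lineInvariant o t' := by
  refine ⟨fun h => (mem_lineSet_iff ho).1 (h ▸ (mem_lineSet_iff ho).2 rfl), fun h => ?_⟩
  ext z
  rw [mem_lineSet_iff ho, mem_lineSet_iff ho, h]

theorem lineInvariant_mem_moduleO {n : ℕ} {ζ : ℂ} (hn : 0 < n) (hζ : IsPrimitiveRoot ζ n)
    (ho : o ∈ moduleO ζ) (hz : z ∈ moduleO ζ) : lineInvariant o z ∈ moduleO ζ :=
  sub_mem (mul_mem hz (conj_mem_moduleO hn hζ ho)) (mul_mem (conj_mem_moduleO hn hζ hz) ho)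

theorem lineInvariant_ne_zero (h : LinearIndependent ℝ ![o, o']) : lineInvariant o o' ≠ 0 := by
  have ho : o ≠ 0 := h.ne_zero 0
  rw [Ne, lineInvariant_eq_zero_iff ho, not_exists]
  exact (LinearIndependent.pair_iff' ho).1 h

theorem eq_of_lineInvariant_eq (h : lineInvariant o o' ≠ 0)
    (hz : lineInvariant o z = lineInvariant o z') (hz' : lineInvariant o' z = lineInvariant o' z') :
    z = z' := by
  have hmul : (z - z') * lineInvariant o o' = 0 := by
    simp only [lineInvariant_apply] at hz hz' ⊢
    linear_combination hz * o' - hz' * o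
  exact sub_eq_zero.1 ((mul_eq_zero.1 hmul).resolve_right h)

theorem conj_lineInvariant (o z : ℂ) : conj (lineInvariant o z) = -lineInvariant o z := by
  simp only [lineInvariant_apply, map_sub, map_mul, Complex.conj_conj]
  ring

/-- The point where the line with direction `o` through `x` meets the line with direction `o'`
through `y`. -/
noncomputable def intersection (o o' x y : ℂ) : ℂ :=
  (lineInvariant o x * o' - lineInvariant o' y * o) / lineInvariant o o'

theorem lineInvariant_intersection_left (h : lineInvariant o o' ≠ 0) (x y : ℂ) :
    lineInvariant o (intersection o o' x y) = lineInvariant o x := by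
  rw [intersection, lineInvariant_apply, map_div₀, conj_lineInvariant, map_sub, map_mul, map_mul,
    conj_lineInvariant, conj_lineInvariant]
  field_simp
  rw [lineInvariant_apply o o']
  ring

theorem lineInvariant_intersection_right (h : lineInvariant o o' ≠ 0) (x y : ℂ) :
    lineInvariant o' (intersection o o' x y) = lineInvariant o' y := by
  rw [intersection, lineInvariant_apply, map_div₀, conj_lineInvariant, map_sub, map_mul, map_mul,
    conj_lineInvariant, conj_lineInvariant]
  field_simp
  rw [lineInvariant_apply o o']
  ring

end Lines

section Lists

variable {n m : ℕ} {ζ : ℂ}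

theorem modEquiv_equivalence (ζ : ℂ) : Equivalence (ModEquiv ζ) where
  refl x := by rw [ModEquiv, sub_self]; exact zero_mem _
  symm h := by simpa [ModEquiv] using neg_mem h
  trans h h' := by simpa [ModEquiv] using add_mem h h'

theorem pointSet_nonempty_iff {l : List (Fin (Nat.totient n) → ℚ)} :
    (pointSet ζ l).Nonempty ↔ l ≠ [] := by
  refine ⟨fun ⟨_, q, hq, _⟩ => List.ne_nil_of_mem hq, fun h => ?_⟩
  obtain ⟨q, hq⟩ := List.exists_mem_of_ne_nil l h
  exact ⟨_, q, hq, rfl⟩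

theorem Entry.line_val (o : ℂ) (e : Entry n) :
    (Entry.line ζ o e).1 = lineSet (ofIntCoords n ζ e.1) o := by
  rw [← ofCoords_intCast]
  rfl

theorem Represents.eq_of_lineInvariant_eq {o : ℂ} {p : Line o → ℕ} {l : List (Entry n)}
    (hl : Represents ζ p l) (ho : o ≠ 0) {e e' : Entry n} (he : e ∈ l) (he' : e' ∈ l)
    (h : lineInvariant o (ofIntCoords n ζ e.1) = lineInvariant o (ofIntCoords n ζ e'.1)) :
    e = e' := by
  refine List.inj_on_of_nodup_map hl.1 he he' (Subtype.ext ?_)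
  rwa [Entry.line_val, Entry.line_val, lineSet_eq_iff ho]

theorem Represents.length_eq_ncard {o : ℂ} {p : Line o → ℕ} {l : List (Entry n)}
    (hl : Represents ζ p l) : l.length = (Function.support p).ncard := by
  classical
  have hsupport : Function.support p = (l.map (Entry.line ζ o)).toFinset := by
    ext ℓ
    rw [hl.2.2, List.coe_toFinset, Set.mem_ofPred_eq, List.mem_map]
  rw [hsupport, Set.ncard_coe_finset, List.toFinset_card_of_nodup hl.1, List.length_map]

variable {o : Fin m → ℂ} {p : (i : Fin m) → Line (o i) → ℕ} {L : Fin m → List (Entry n)}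

theorem length_le_maxSupport (hL : ∀ i, Represents ζ (p i) (L i)) (i : Fin m) :
    (L i).length ≤ maxSupport p :=
  (hL i).length_eq_ncard.trans_le <|
    Finset.le_sup (f := fun i => (Function.support (p i)).ncard) (Finset.mem_univ i)

theorem mem_grid_iff (hL : ∀ i, Represents ζ (p i) (L i)) (ho : ∀ i, o i ≠ 0) {z : ℂ} :
    z ∈ grid p ↔ ∀ i, ∃ e ∈ L i,
      lineInvariant (o i) z = lineInvariant (o i) (ofIntCoords n ζ e.1) := by
  simp only [grid, Set.mem_iInter, Set.mem_iUnion, exists_prop, (hL _).2.2]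
  refine forall_congr' fun i => ⟨?_, ?_⟩
  · rintro ⟨_, ⟨e, he, rfl⟩, hz⟩
    rw [Entry.line_val, mem_lineSet_iff (ho i)] at hz
    exact ⟨e, he, hz⟩
  · rintro ⟨e, he, hz⟩
    refine ⟨_, ⟨e, he, rfl⟩, ?_⟩
    rwa [Entry.line_val, mem_lineSet_iff (ho i)]

theorem encodeInput_eq (L : Fin m → List (Entry n)) :
    encodeInput L = ((List.finRange m).flatMap fun i => GridData.listInput (L i)).map
      fun z : ℤ => (z : ℝ) := by
  simp [encodeInput, GridData.listInput, GridData.entryInput, List.ofFn_eq_map, List.flatMap_def,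
    List.map_flatten, Function.comp_def]

theorem encodeOutput_eq (Q : List (List (Fin (Nat.totient n) → ℚ))) :
    encodeOutput Q = (GridData.tape Q).map fun q : ℚ => (q : ℝ) := by
  simp [encodeOutput, GridData.tape, GridData.pointsOutput, List.ofFn_eq_map, List.flatMap_def,
    List.map_flatten, Function.comp_def]

end Lists

section Residues

variable {d N : ℕ} {v w : Fin d → ℤ}

/-- The vectors with coordinates in `{0, …, N - 1}`, which represent the integral vectors modulo
`N`. -/
noncomputable def residues (d N : ℕ) : List (Fin d → ℤ) :=
  (Fintype.piFinset fun _ => Finset.Ico (0 : ℤ) N).toList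

theorem nodup_residues (d N : ℕ) : (residues d N).Nodup := Finset.nodup_toList _

theorem mem_residues_iff : v ∈ residues d N ↔ ∀ k, 0 ≤ v k ∧ v k < N := by
  simp only [residues, Finset.mem_toList, Fintype.mem_piFinset, Finset.mem_Ico]

theorem exists_mem_residues_modEq (hN : 0 < N) (w : Fin d → ℤ) :
    ∃ v ∈ residues d N, ∀ k, w k ≡ v k [ZMOD N] := by
  have hN' : (0 : ℤ) < N := by exact_mod_cast hN
  exact ⟨fun k => w k % N, mem_residues_iff.2 fun k =>
    ⟨Int.emod_nonneg _ hN'.ne', Int.emod_lt_of_pos _ hN'⟩, fun k => (Int.mod_modEq _ _).symm⟩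

theorem eq_of_mem_residues_of_modEq (hv : v ∈ residues d N) (hw : w ∈ residues d N)
    (h : ∀ k, v k ≡ w k [ZMOD N]) : v = w := by
  rw [mem_residues_iff] at hv hw
  funext k
  rw [← Int.emod_eq_of_lt (hv k).1 (hv k).2, ← Int.emod_eq_of_lt (hw k).1 (hw k).2]
  exact h k

end Residues

namespace GridData

section Models

variable {n m : ℕ} {ζ : ℂ} {𝒟 : GridData (Nat.totient n) m}

theorem ofCoords_point (𝒟 : GridData (Nat.totient n) m) (w : Fin (Nat.totient n) → ℤ) :
    ofCoords ζ (𝒟.point w) = ofIntCoords n ζ w / 𝒟.denom := by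
  refine (ofCoords_mul w _).trans ?_
  rw [Rat.cast_div, Rat.cast_one, Rat.cast_natCast, mul_one_div]

theorem point_injective (h : 0 < 𝒟.denom) : Function.Injective 𝒟.point := by
  intro w w' hww'
  have hdenom : (1 / 𝒟.denom : ℚ) ≠ 0 := by positivity
  funext k
  exact_mod_cast mul_right_cancel₀ hdenom (congrFun hww' k)

theorem modEquiv_point_iff (hn : 0 < n) (hζ : IsPrimitiveRoot ζ n)
    (v w : Fin (Nat.totient n) → ℤ) :
    ModEquiv ζ (ofCoords ζ (𝒟.point w)) (ofCoords ζ (𝒟.point v)) ↔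
      ∀ k, ∃ z : ℤ, ((w k - v k : ℤ) : ℚ) * (1 / 𝒟.denom) = z := by
  rw [ModEquiv, ofCoords_point, ofCoords_point, ← sub_div, ← map_sub, ← ofCoords_point,
    ofCoords_mem_moduleO_iff hn hζ]
  rfl

theorem modEquiv_point_iff_modEq (hn : 0 < n) (hζ : IsPrimitiveRoot ζ n) (h : 0 < 𝒟.denom)
    (v w : Fin (Nat.totient n) → ℤ) :
    ModEquiv ζ (ofCoords ζ (𝒟.point w)) (ofCoords ζ (𝒟.point v)) ↔
      ∀ k, v k ≡ w k [ZMOD 𝒟.denom] := by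
  have hdenom : (𝒟.denom : ℚ) ≠ 0 := by positivity
  rw [modEquiv_point_iff hn hζ]
  refine forall_congr' fun k => Iff.trans (exists_congr fun z => ?_) Int.modEq_iff_dvd.symm
  rw [mul_one_div, div_eq_iff hdenom, mul_comm]
  exact_mod_cast Iff.rfl

/-- The data `𝒟` describe the lines with the directions `o` through points of `ℤ[ζ]` in terms of
the coordinates of these points. -/
structure Models (𝒟 : GridData (Nat.totient n) m) (ζ : ℂ) (o : Fin m → ℂ) : Prop where
  denom_pos : 0 < 𝒟.denom
  ne_zero : ∀ i, o i ≠ 0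
  lineInvariant_ne_zero : lineInvariant (o 𝒟.i₀) (o 𝒟.i₁) ≠ 0
  key : ∀ i v, ofIntCoords n ζ (𝒟.key i v) = lineInvariant (o i) (ofIntCoords n ζ v)
  point_meet : ∀ x y : Entry n, ofCoords ζ (𝒟.point (𝒟.meet x y)) =
    intersection (o 𝒟.i₀) (o 𝒟.i₁) (ofIntCoords n ζ x.1) (ofIntCoords n ζ y.1)

theorem exists_models {o : Fin m → ℂ} (hn : 0 < n) (hζ : IsPrimitiveRoot ζ n)
    (ho : ∀ i, o i ∈ moduleO ζ ∧ o i ≠ 0) {i₀ i₁ : Fin m}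
    (h : LinearIndependent ℝ ![o i₀, o i₁]) :
    ∃ 𝒟 : GridData (Nat.totient n) m, 𝒟.Models ζ o := by
  have hD := CycloTomo.lineInvariant_ne_zero h
  have hI (i : Fin m) {z : ℂ} (hz : z ∈ moduleO ζ) : lineInvariant (o i) z ∈ moduleO ζ :=
    lineInvariant_mem_moduleO hn hζ (ho i).1 hz
  obtain ⟨E, hE, N, hN, hDE⟩ := exists_mul_eq_natCast hn hζ (hI i₀ (ho i₁).1) hD
  choose key hkey using fun i => exists_linearMap_ofIntCoords hn hζ
    (lineInvariant (o i)).toAddMonoidHom fun z hz => hI i hz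
  obtain ⟨fst, hfst⟩ := exists_linearMap_ofIntCoords hn hζ
    ((AddMonoidHom.mulLeft (E * o i₁)).comp (lineInvariant (o i₀)).toAddMonoidHom)
    fun z hz => mul_mem (mul_mem hE (ho i₁).1) (hI i₀ hz)
  obtain ⟨snd, hsnd⟩ := exists_linearMap_ofIntCoords hn hζ
    ((AddMonoidHom.mulLeft (-(E * o i₀))).comp (lineInvariant (o i₁)).toAddMonoidHom)
    fun z hz => mul_mem (neg_mem (mul_mem hE (ho i₀).1)) (hI i₁ hz)
  refine ⟨⟨N, key, fst, snd, i₀, i₁⟩, hN, fun i => (ho i).2, hD, hkey, fun x y => ?_⟩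
  have hN' : (N : ℂ) ≠ 0 := by exact_mod_cast hN.ne'
  rw [ofCoords_point, meet, map_add, hfst, hsnd, intersection, div_eq_div_iff hN' hD, ← hDE]
  simp only [AddMonoidHom.comp_apply, AddMonoidHom.coe_mulLeft, LinearMap.toAddMonoidHom_coe]
  ring

namespace Models

variable {o : Fin m → ℂ} {p : (i : Fin m) → Line (o i) → ℕ} {L : Fin m → List (Entry n)}

theorem lineInvariant_fst (h𝒟 : 𝒟.Models ζ o) (x y : Entry n) :
    lineInvariant (o 𝒟.i₀) (ofCoords ζ (𝒟.point (𝒟.meet x y))) =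
      lineInvariant (o 𝒟.i₀) (ofIntCoords n ζ x.1) := by
  rw [h𝒟.point_meet, lineInvariant_intersection_left h𝒟.lineInvariant_ne_zero]

theorem lineInvariant_snd (h𝒟 : 𝒟.Models ζ o) (x y : Entry n) :
    lineInvariant (o 𝒟.i₁) (ofCoords ζ (𝒟.point (𝒟.meet x y))) =
      lineInvariant (o 𝒟.i₁) (ofIntCoords n ζ y.1) := by
  rw [h𝒟.point_meet, lineInvariant_intersection_right h𝒟.lineInvariant_ne_zero]

theorem exists_meets_of_mem_grid (h𝒟 : 𝒟.Models ζ o) (hL : ∀ i, Represents ζ (p i) (L i)) {z : ℂ}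
    (hz : z ∈ grid p) : ∃ w ∈ 𝒟.meets L, ofCoords ζ (𝒟.point w) = z := by
  rw [mem_grid_iff hL h𝒟.ne_zero] at hz
  obtain ⟨x, hx, hzx⟩ := hz 𝒟.i₀
  obtain ⟨y, hy, hzy⟩ := hz 𝒟.i₁
  exact ⟨𝒟.meet x y, List.mem_flatMap.2 ⟨x, hx, List.mem_map_of_mem hy⟩,
    eq_of_lineInvariant_eq h𝒟.lineInvariant_ne_zero ((h𝒟.lineInvariant_fst x y).trans hzx.symm)
      ((h𝒟.lineInvariant_snd x y).trans hzy.symm)⟩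

theorem key_eq_iff (h𝒟 : 𝒟.Models ζ o) (hn : 0 < n) (hζ : IsPrimitiveRoot ζ n) (i : Fin m)
    (v w : Fin (Nat.totient n) → ℤ) :
    (𝒟.denom : ℤ) • 𝒟.key i v = 𝒟.key i w ↔
      lineInvariant (o i) (ofCoords ζ (𝒟.point w)) = lineInvariant (o i) (ofIntCoords n ζ v) := by
  have hdenom : (𝒟.denom : ℂ) ≠ 0 := by exact_mod_cast h𝒟.denom_pos.ne'
  have hw : ofIntCoords n ζ w = (𝒟.denom : ℤ) • ofCoords ζ (𝒟.point w) := by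
    rw [ofCoords_point, zsmul_eq_mul, Int.cast_natCast, mul_div_cancel₀ _ hdenom]
  rw [← (ofIntCoords_injective hn hζ).eq_iff, map_zsmul, h𝒟.key, h𝒟.key, hw, map_zsmul, eq_comm,
    zsmul_eq_mul, zsmul_eq_mul, Int.cast_natCast, mul_right_inj' hdenom]

theorem accepts_iff (h𝒟 : 𝒟.Models ζ o) (hn : 0 < n) (hζ : IsPrimitiveRoot ζ n)
    (hL : ∀ i, Represents ζ (p i) (L i)) (v w : Fin (Nat.totient n) → ℤ) :
    𝒟.Accepts L v w ↔ ofCoords ζ (𝒟.point w) ∈ grid p ∧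
      ModEquiv ζ (ofCoords ζ (𝒟.point w)) (ofCoords ζ (𝒟.point v)) := by
  simp only [Accepts, h𝒟.key_eq_iff hn hζ, mem_grid_iff hL h𝒟.ne_zero, modEquiv_point_iff hn hζ]

theorem mem_pointSet_points_iff (h𝒟 : 𝒟.Models ζ o) (hn : 0 < n) (hζ : IsPrimitiveRoot ζ n)
    (hL : ∀ i, Represents ζ (p i) (L i)) {v : Fin (Nat.totient n) → ℤ} {z : ℂ} :
    z ∈ pointSet ζ (𝒟.points L v) ↔ z ∈ grid p ∧ ModEquiv ζ z (ofCoords ζ (𝒟.point v)) := by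
  simp only [pointSet, points, Set.mem_ofPred_eq, List.mem_map, List.mem_filter, decide_eq_true_eq,
    h𝒟.accepts_iff hn hζ hL]
  constructor
  · rintro ⟨_, ⟨w, ⟨-, hw⟩, rfl⟩, rfl⟩
    exact hw
  · intro hz
    obtain ⟨w, hw, rfl⟩ := h𝒟.exists_meets_of_mem_grid hL hz.1
    exact ⟨_, ⟨w, ⟨hw, hz⟩, rfl⟩, rfl⟩

theorem nodup_meets (h𝒟 : 𝒟.Models ζ o) (hL : ∀ i, Represents ζ (p i) (L i)) :
    (𝒟.meets L).Nodup := by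
  have hprod : 𝒟.meets L = ((L 𝒟.i₀).product (L 𝒟.i₁)).map fun x => 𝒟.meet x.1 x.2 := by
    simp [meets, List.product, List.map_flatMap, Function.comp_def]
  have hnodup (i : Fin m) : (L i).Nodup := (hL i).1.of_map _
  rw [hprod]
  refine List.Nodup.map_on ?_ ((hnodup _).product (hnodup _))
  rintro ⟨x, y⟩ hxy ⟨x', y'⟩ hxy' heq
  rw [List.pair_mem_product] at hxy hxy'
  refine Prod.ext ((hL _).eq_of_lineInvariant_eq (h𝒟.ne_zero _) hxy.1 hxy'.1 ?_)
    ((hL _).eq_of_lineInvariant_eq (h𝒟.ne_zero _) hxy.2 hxy'.2 ?_)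
  · rw [← h𝒟.lineInvariant_fst x y, ← h𝒟.lineInvariant_fst x' y', heq]
  · rw [← h𝒟.lineInvariant_snd x y, ← h𝒟.lineInvariant_snd x' y', heq]

theorem nodup_points (h𝒟 : 𝒟.Models ζ o) (hL : ∀ i, Represents ζ (p i) (L i))
    (v : Fin (Nat.totient n) → ℤ) : (𝒟.points L v).Nodup :=
  ((h𝒟.nodup_meets hL).filter _).map (point_injective h𝒟.denom_pos)

theorem pointSet_points_eq (h𝒟 : 𝒟.Models ζ o) (hn : 0 < n) (hζ : IsPrimitiveRoot ζ n)
    (hL : ∀ i, Represents ζ (p i) (L i)) {v : Fin (Nat.totient n) → ℤ} {x : ℂ}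
    (hx : ModEquiv ζ x (ofCoords ζ (𝒟.point v))) :
    pointSet ζ (𝒟.points L v) = {y | y ∈ grid p ∧ ModEquiv ζ x y} := by
  have hequiv := modEquiv_equivalence ζ
  ext y
  rw [h𝒟.mem_pointSet_points_iff hn hζ hL]
  exact and_congr_right fun _ =>
    ⟨fun hy => hequiv.trans hx (hequiv.symm hy), fun hy => hequiv.trans (hequiv.symm hy) hx⟩

theorem mem_classesIn_iff (h𝒟 : 𝒟.Models ζ o) (hn : 0 < n) (hζ : IsPrimitiveRoot ζ n)
    (hL : ∀ i, Represents ζ (p i) (L i)) {A : Set ℂ} :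
    A ∈ classesIn ζ (grid p) ↔ A ∈ (𝒟.classes L (residues _ 𝒟.denom)).map (pointSet ζ) := by
  simp only [classes, List.mem_map, List.mem_filter, decide_eq_true_eq,
    ← pointSet_nonempty_iff (ζ := ζ)]
  constructor
  · rintro ⟨x, hx, rfl⟩
    obtain ⟨w, -, rfl⟩ := h𝒟.exists_meets_of_mem_grid hL hx
    obtain ⟨v, hv, hwv⟩ := exists_mem_residues_modEq h𝒟.denom_pos w
    have hxv := (modEquiv_point_iff_modEq hn hζ h𝒟.denom_pos v w).2 fun k => (hwv k).symm
    exact ⟨_, ⟨⟨v, hv, rfl⟩, _, (h𝒟.mem_pointSet_points_iff hn hζ hL).2 ⟨hx, hxv⟩⟩,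
      h𝒟.pointSet_points_eq hn hζ hL hxv⟩
  · rintro ⟨_, ⟨⟨v, -, rfl⟩, x, hx⟩, rfl⟩
    obtain ⟨hxG, hxv⟩ := (h𝒟.mem_pointSet_points_iff hn hζ hL).1 hx
    exact ⟨x, hxG, h𝒟.pointSet_points_eq hn hζ hL hxv⟩

theorem nodup_map_pointSet_classes (h𝒟 : 𝒟.Models ζ o) (hn : 0 < n) (hζ : IsPrimitiveRoot ζ n)
    (hL : ∀ i, Represents ζ (p i) (L i)) :
    ((𝒟.classes L (residues _ 𝒟.denom)).map (pointSet ζ)).Nodup := by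
  rw [classes, List.filter_map, List.map_map]
  refine List.Nodup.map_on ?_ ((nodup_residues _ _).filter _)
  intro v hv w hw hvw
  simp only [List.mem_filter, Function.comp_apply, decide_eq_true_eq,
    ← pointSet_nonempty_iff (ζ := ζ)] at hv hw hvw
  obtain ⟨hv, z, hzv⟩ := hv
  have hzw := hvw ▸ hzv
  rw [h𝒟.mem_pointSet_points_iff hn hζ hL] at hzv hzw
  have hequiv := modEquiv_equivalence ζ
  refine eq_of_mem_residues_of_modEq hv hw.1 ?_
  rw [← modEquiv_point_iff_modEq hn hζ h𝒟.denom_pos]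
  exact hequiv.trans (hequiv.symm hzw.2) hzv.2

theorem listsFamily (h𝒟 : 𝒟.Models ζ o) (hn : 0 < n) (hζ : IsPrimitiveRoot ζ n)
    (hL : ∀ i, Represents ζ (p i) (L i)) :
    ListsFamily ζ (classesIn ζ (grid p)) (𝒟.classes L (residues _ 𝒟.denom)) := by
  refine ⟨fun l hl => ?_, h𝒟.nodup_map_pointSet_classes hn hζ hL,
    fun A => h𝒟.mem_classesIn_iff hn hζ hL⟩
  obtain ⟨v, -, rfl⟩ := List.mem_map.1 (List.mem_filter.1 hl).1
  exact h𝒟.nodup_points hL v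

end Models

end Models

end GridData

end CycloTomo

theorem theorem1_general {n : ℕ} (hn : 0 < n) {ζ : ℂ} (hζ : IsPrimitiveRoot ζ n) {m : ℕ}
    {o : Fin m → ℂ} (ho : ∀ i, o i ∈ CycloTomo.moduleO ζ ∧ o i ≠ 0) {i₀ i₁ : Fin m}
    (hindep : LinearIndependent ℝ ![o i₀, o i₁]) :
    (∀ q : Fin (Nat.totient n) → ℚ,
      CycloTomo.ofCoords ζ q ∈ CycloTomo.moduleO ζ ↔ ∀ k, ∃ z : ℤ, q k = (z : ℚ)) ∧
    ∃ (P : RealRAM.Program) (C : ℕ),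
      ∀ (p : (i : Fin m) → CycloTomo.Line (o i) → ℕ) (L : Fin m → List (CycloTomo.Entry n)),
        (∀ i, CycloTomo.Represents ζ (p i) (L i)) →
        ∃ (t : ℕ) (Q : List (List (Fin (Nat.totient n) → ℚ))),
          t ≤ C * (CycloTomo.maxSupport p ^ 2 + 1) ∧
          RealRAM.HaltsWith P (CycloTomo.encodeInput L) t (CycloTomo.encodeOutput Q) ∧
          CycloTomo.ListsFamily ζ (CycloTomo.classesIn ζ (CycloTomo.grid p)) Q := by
  refine ⟨CycloTomo.ofCoords_mem_moduleO_iff hn hζ, ?_⟩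
  obtain ⟨𝒟, h𝒟⟩ := CycloTomo.GridData.exists_models hn hζ ho hindep
  set R := CycloTomo.residues (Nat.totient n) 𝒟.denom
  obtain ⟨K, hK⟩ := 𝒟.costBound_program R
  refine ⟨(𝒟.program R).toProgram, K * 2, fun p L hL => ?_⟩
  obtain ⟨t, ht, hP⟩ := RealRAM.Stmt.haltsWith_toProgram
    (𝒟.wp_program (CycloTomo.length_le_maxSupport hL) R)
  rw [← CycloTomo.encodeInput_eq, ← CycloTomo.encodeOutput_eq] at hP
  refine ⟨t, 𝒟.classes L R, ?_, hP, h𝒟.listsFamily hn hζ hL⟩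
  calc t ≤ K * (CycloTomo.maxSupport p + 1) ^ 2 := ht.trans (hK _)
    _ ≤ K * (2 * (CycloTomo.maxSupport p ^ 2 + 1 ^ 2)) := by gcongr; exact add_sq_le
    _ = K * 2 * (CycloTomo.maxSupport p ^ 2 + 1) := by rw [mul_assoc, one_pow]

theorem theorem1 (n : ℕ) (hn : 3 ≤ n) (ζ : ℂ) (hζ : IsPrimitiveRoot ζ n)
    (m : ℕ) (hm : 2 ≤ m) (o : Fin m → ℂ)
    (ho : ∀ i, o i ∈ CycloTomo.moduleO ζ ∧ o i ≠ 0)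
    (hpar : Pairwise fun i j => LinearIndependent ℝ ![o i, o j]) :
    (∀ q : Fin (Nat.totient n) → ℚ,
      CycloTomo.ofCoords ζ q ∈ CycloTomo.moduleO ζ ↔ ∀ k, ∃ z : ℤ, q k = (z : ℚ)) ∧
    ∃ (P : RealRAM.Program) (C : ℕ),
      ∀ p : (i : Fin m) → CycloTomo.Line (o i) → ℕ,
        (∀ i, (Function.support (p i)).Finite) →
        (∀ i, Function.support (p i) ⊆ CycloTomo.moduleLines ζ (o i)) →
        ∀ L : Fin m → List (CycloTomo.Entry n),
          (∀ i, CycloTomo.Represents ζ (p i) (L i)) →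
          ∃ (t : ℕ) (Q : List (List (Fin (Nat.totient n) → ℚ))),
            t ≤ C * (CycloTomo.maxSupport p ^ 2 + 1) ∧
            RealRAM.HaltsWith P (CycloTomo.encodeInput L) t (CycloTomo.encodeOutput Q) ∧
            CycloTomo.ListsFamily ζ (CycloTomo.classesIn ζ (CycloTomo.grid p)) Q := by
  obtain ⟨hcoords, P, C, hP⟩ := theorem1_general (by lia) hζ ho
    (hpar (i := ⟨0, by lia⟩) (j := ⟨1, by lia⟩) (by simp))
  exact ⟨hcoords, P, C, fun p _ _ L hL => hP p L hL⟩
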